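/- All topological spaces are compactly generated and weak Hausdorff; products, subspaces and colimits of spaces are formed in this category. A *flow* $X$ consists of a set $X^0$ of states (with the discrete topology), a space $\mathbb{P}X$ of paths, continuous maps $s,t:\mathbb{P}X\to X^0$, and a continuous associative composition $*:\{(x,y)\in\mathbb{P}X\times\mathbb{P}X : t(x)=s(y)\}\to\mathbb{P}X$ with $s(x*y)=s(x)$ and $t(x*y)=t(y)$. A *morphism of flows* $f:X\to Y$ is a map $X^0\to Y^0$ together with a continuous map $\mathbb{P}X\to\mathbb{P}Y$, compatible with $s$, $t$ and $*$. Two morphisms $f,g:X\to Y$ are *S-homotopic* if there is a map $H:(X^0\sqcup\mathbb{P}X)\times[0,1]\to Y^0\sqcup\mathbb{P}Y$, continuous, such that every $H(-,u)$ is a morphism of flows and $H(-,0)=f$, $H(-,1)=g$. A morphism $f:X\to Y$ is an *S-homotopy equivalence* if there is a morphism $g:Y\to X$ such that $f\circ g$ is S-homotopic to $\mathrm{Id}_Y$ and $g\circ f$ is S-homotopic to $\mathrm{Id}_X$. For a space $U$ and a flow $X$, the flow $U\boxtimes X$ is the flow with set of states $X^0$ generated freely by the space of paths $U\times\mathbb{P}X$,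 whose points are written $u\boxtimes x$, with $s(u\boxtimes x)=s(x)$ and $t(u\boxtimes x)=t(x)$, subject to the relations $(u\boxtimes x)*(u\boxtimes y)=u\boxtimes(x*y)$ for $u\in U$ and $x,y\in\mathbb{P}X$ with $t(x)=s(y)$. For a state $\alpha\in X^0$ put $u\boxtimes\alpha=\alpha$. The construction is functorial in $U$ and $X$. A morphism of flows $i:X\to Y$ is an *S-cofibration* if for every flow $Z$ and all morphisms of flows $g:Y\to Z$ and $H:[0,1]\boxtimes X\to Z$ with $H(0\boxtimes x)=g(i(x))$ for all $x\in X$, there is a morphism of flows $\overline H:[0,1]\boxtimes Y\to Z$ with $\overline H(u\boxtimes i(x))=H(u\boxtimes x)$ and $\overline H(0\boxtimes y)=g(y)$ for all $u\in[0,1]$, $x\in X$, $y\in Y$ (states and paths). An S-cofibration is *acyclic* if it is an S-homotopy equivalence. A pair $(Y,B)$, with $Y$ a space and $B\subseteq Y$ a subspace, is an *NDR pair* if there are continuous maps $u:Y\to[0,1]$ and $h:[0,1]\times Y\to Y$ such that $B=u^{-1}(0)$, $h(0,y)=y$ for all $y\in Y$, $h(t,b)=b$ for all $t\in[0,1]$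 and $b\in B$, and $h(1,y)\in B$ whenever $u(y)<1$. It is a *DR pair* if $u,h$ can moreover be chosen with $h(1,y)\in B$ for all $y\in Y$. **Theorem.** Let $(Y,B)$ be an NDR pair of topological spaces and let $i:A\to X$ be an S-cofibration of flows. Then the canonical morphism of flows $$(Y,B)\boxtimes i:\ (Y\boxtimes A)\sqcup_{B\boxtimes A}(B\boxtimes X)\longrightarrow Y\boxtimes X$$ (from the pushout in the category of flows, induced by $Y\boxtimes i$ and by the inclusion $B\subseteq Y$) is an S-cofibration. If moreover $(Y,B)$ is a DR pair, or $i$ is an acyclic S-cofibration, then the S-cofibration $(Y,B)\boxtimes i$ is acyclic. -/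

import Mathlib

open CategoryTheory CategoryTheory.Limits Topology

universe u

/-! ### Compactly generated weak Hausdorff spaces -/

/-- A space is weak Hausdorff if every continuous image of a compact Hausdorff space in it is
closed. Compactly generated spaces are Mathlib's `CompactlyGeneratedSpace`. -/
class WeaklyHausdorffSpace (X : Type u) [TopologicalSpace X] : Prop where
  isClosed_range : ∀ (K : Type u) [TopologicalSpace K] [CompactSpace K] [T2Space K] (f : K → X),
    Continuous f → IsClosed (Set.range f)

theorem isClosed_eqLocus_of_weaklyHausdorff {X : Type u} [TopologicalSpace X]
    [WeaklyHausdorffSpace X] (K : Type u) [TopologicalSpace K] [CompactSpace K] [T2Space K]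
    (f g : K → X) (hf : Continuous f) (hg : Continuous g) : IsClosed {k | f k = g k} := by
  let h : K ⊕ K → X := Sum.elim f g
  have hh : Continuous h := hf.sumElim hg
  have hcl : ∀ C : Set (K ⊕ K), IsClosed C → IsClosed (h '' C) := by
    intro C hC
    have : CompactSpace C := isCompact_iff_compactSpace.1 hC.isCompact
    have h1 := WeaklyHausdorffSpace.isClosed_range C (fun c : C => h c.1)
      (hh.comp continuous_subtype_val)
    have h2 : Set.range (fun c : C => h c.1) = h '' C := by
      ext x; simp
    rwa [h2] at h1
  have hpt : ∀ x : X, IsClosed ({x} : Set X) := by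
    intro x
    have h1 := WeaklyHausdorffSpace.isClosed_range PUnit (fun _ : PUnit.{u+1} => x)
      continuous_const
    rwa [Set.range_const] at h1
  rw [← isOpen_compl_iff, isOpen_iff_forall_mem_open]
  intro k hk
  have hk' : f k ≠ g k := hk
  obtain ⟨U, V, hU, hV, hfU, hgV, hUV⟩ := normal_separation
    ((hpt (f k)).preimage hh) ((hpt (g k)).preimage hh)
    (Disjoint.preimage h (by simpa using hk'))
  refine ⟨f ⁻¹' (h '' Uᶜ)ᶜ ∩ g ⁻¹' (h '' Vᶜ)ᶜ, ?_, ?_, ?_⟩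
  · rintro k' ⟨h1, h2⟩ (h3 : f k' = g k')
    have hu : Sum.inl k' ∈ U := by
      by_contra hn
      exact h1 ⟨Sum.inl k', hn, rfl⟩
    have hv : Sum.inl k' ∈ V := by
      by_contra hn
      exact h2 ⟨Sum.inl k', hn, h3⟩
    exact Set.disjoint_left.1 hUV hu hv
  · exact ((hcl _ hU.isClosed_compl).isOpen_compl.preimage hf).inter
      ((hcl _ hV.isClosed_compl).isOpen_compl.preimage hg)
  · refine ⟨?_, ?_⟩
    · rintro ⟨l, hl, hl'⟩
      exact hl (hfU hl')
    · rintro ⟨l, hl, hl'⟩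
      exact hl (hgV hl')

theorem weaklyHausdorff_of_isClosed_eqLocus {X : Type u} [TopologicalSpace X]
    [CompactlyGeneratedSpace X]
    (H : ∀ (K : Type u) [TopologicalSpace K] [CompactSpace K] [T2Space K] (f g : K → X),
      Continuous f → Continuous g → IsClosed {k | f k = g k}) : WeaklyHausdorffSpace X where
  isClosed_range K _ _ _ f hf := by
    refine CompactlyGeneratedSpace.isClosed' fun L _ _ _ g hg => ?_
    have h1 := H (K × L) (fun p => f p.1) (fun p => g p.2) (hf.comp continuous_fst)
      (hg.comp continuous_snd)
    have h2 := isClosedMap_snd_of_compactSpace _ h1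
    convert h2 using 1
    ext l
    simp

/-- The Kelleyfication of a topology is compactly generated. -/
theorem compactlyGeneratedSpace_kelley {X : Type u} (t : TopologicalSpace X) :
    @CompactlyGeneratedSpace X (@TopologicalSpace.compactlyGenerated.{u} X t) := by
  let _ := t
  exact @uCompactlyGeneratedSpace_of_coinduced.{u} _ _ _
    (@TopologicalSpace.compactlyGenerated.{u} X t) _ _
    continuous_coinduced_rng rfl

/-- A continuous map out of a compactly generated space is continuous into the Kelleyfication. -/
theorem continuous_kelley {Z X : Type u} [TopologicalSpace Z] [CompactlyGeneratedSpace Z]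
    {t : TopologicalSpace X} {f : Z → X} (hf : Continuous f) :
    Continuous[_, @TopologicalSpace.compactlyGenerated.{u} X t] f := by
  refine @continuous_from_uCompactlyGeneratedSpace _ _ _
    (@TopologicalSpace.compactlyGenerated.{u} X t) _ f fun S g => ?_
  let F : (Σ (i : (S : CompHaus.{u}) × C(S, X)), i.fst) → X := fun x => x.1.2 x.2
  have h1 : Continuous[_, @TopologicalSpace.compactlyGenerated.{u} X t] F :=
    continuous_coinduced_rng
  have h2 : Continuous (fun s : S =>
      (⟨⟨S, ⟨f ∘ g, hf.comp g.2⟩⟩, s⟩ : Σ (i : (S : CompHaus.{u}) × C(S, X)), i.fst)) :=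
    continuous_sigmaMk (ι := (S : CompHaus.{u}) × C(S, X)) (σ := fun i => i.fst)
      (i := ⟨S, ⟨f ∘ g, hf.comp g.2⟩⟩)
  exact @Continuous.comp _ _ _ _ _ (@TopologicalSpace.compactlyGenerated.{u} X t) _ F h1 h2

theorem kelley_le {X : Type u} (t : TopologicalSpace X) :
    @TopologicalSpace.compactlyGenerated.{u} X t ≤ t := by
  rw [← continuous_id_iff_le]
  exact @continuous_from_compactlyGenerated.{u} _ _ t t id fun S g => g.2

/-! ### Flows -/

/-- A flow: a set `State` (the `0`-skeleton), a compactly generated weak Hausdorff space `Path` of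
(non-constant) execution paths, continuous source and target maps to the discrete space `State`,
and a continuous associative composition of composable paths. The set of composable pairs is a
fibre product formed in compactly generated spaces. -/
structure Flot : Type (u + 1) where
  State : Type u
  Path : Type u
  [top : TopologicalSpace Path]
  [cg : CompactlyGeneratedSpace Path]
  [wh : WeaklyHausdorffSpace Path]
  src : Path → State
  tgt : Path → State
  continuous_src : Continuous[top, ⊥] src
  continuous_tgt : Continuous[top, ⊥] tgt
  comp : ∀ x y : Path, tgt x = src y → Path
  continuous_comp :
    Continuous[@TopologicalSpace.compactlyGenerated.{u} {p : Path × Path // tgt p.1 = src p.2} _,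
      top] fun p : {p : Path × Path // tgt p.1 = src p.2} => comp p.1.1 p.1.2 p.2
  src_comp : ∀ x y h, src (comp x y h) = src x
  tgt_comp : ∀ x y h, tgt (comp x y h) = tgt y
  comp_assoc : ∀ x y z (h : tgt x = src y) (h' : tgt y = src z),
    comp (comp x y h) z ((tgt_comp x y h).trans h') =
      comp x (comp y z h') (h.trans (src_comp y z h').symm)

namespace Flot

attribute [instance] top cg wh

/-- The `0`-skeleton carries the discrete topology. -/
instance (X : Flot.{u}) : TopologicalSpace X.State := ⊥

instance (X : Flot.{u}) : DiscreteTopology X.State := ⟨rfl⟩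

/-- Morphisms of flows. -/
@[ext]
structure Hom (X Y : Flot.{u}) where
  onState : X.State → Y.State
  onPath : X.Path → Y.Path
  continuous_onPath : Continuous onPath
  src_onPath : ∀ x, Y.src (onPath x) = onState (X.src x)
  tgt_onPath : ∀ x, Y.tgt (onPath x) = onState (X.tgt x)
  onPath_comp : ∀ x y (h : X.tgt x = X.src y), onPath (X.comp x y h) =
    Y.comp (onPath x) (onPath y)
      ((tgt_onPath x).trans ((congrArg onState h).trans (src_onPath y).symm))

instance : Category Flot.{u} where
  Hom := Hom
  id X :=
    { onState := id
      onPath := id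
      continuous_onPath := continuous_id
      src_onPath := fun _ => rfl
      tgt_onPath := fun _ => rfl
      onPath_comp := fun _ _ _ => rfl }
  comp f g :=
    { onState := g.onState ∘ f.onState
      onPath := g.onPath ∘ f.onPath
      continuous_onPath := g.continuous_onPath.comp f.continuous_onPath
      src_onPath := fun x => by simp [g.src_onPath, f.src_onPath]
      tgt_onPath := fun x => by simp [g.tgt_onPath, f.tgt_onPath]
      onPath_comp := fun x y h => by simp [g.onPath_comp, f.onPath_comp] }

@[simp] theorem id_onState (X : Flot.{u}) : Hom.onState (𝟙 X) = id := rfl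
@[simp] theorem id_onPath (X : Flot.{u}) : Hom.onPath (𝟙 X) = id := rfl
@[simp] theorem comp_onState {X Y Z : Flot.{u}} (f : X ⟶ Y) (g : Y ⟶ Z) :
    Hom.onState (f ≫ g) = Hom.onState g ∘ Hom.onState f := rfl
@[simp] theorem comp_onPath {X Y Z : Flot.{u}} (f : X ⟶ Y) (g : Y ⟶ Z) :
    Hom.onPath (f ≫ g) = Hom.onPath g ∘ Hom.onPath f := rfl

theorem hom_ext {X Y : Flot.{u}} {f g : X ⟶ Y} (h : ∀ a, Hom.onState f a = Hom.onState g a)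
    (h' : ∀ x, Hom.onPath f x = Hom.onPath g x) : f = g :=
  Hom.ext (funext h) (funext h')

/-! ### Flows given by generators and relations -/

/-- Generators and relations for a flow: a set of states, a space `Gen` of generating paths with
locally constant source and target, relations `g = g'` between generators, and relations
`g * g' = g''`. -/
structure Presentation : Type (u + 1) where
  State : Type u
  Gen : Type u
  top : TopologicalSpace Gen
  cg : CompactlyGeneratedSpace Gen
  src : Gen → State
  tgt : Gen → State
  continuous_src : Continuous[top, ⊥] src
  continuous_tgt : Continuous[top, ⊥] tgt
  eqRel : Gen → Gen → Prop
  mulRel : Gen → Gen → Gen → Prop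
  eqRel_src : ∀ g g', eqRel g g' → src g = src g'
  eqRel_tgt : ∀ g g', eqRel g g' → tgt g = tgt g'
  mulRel_composable : ∀ g g' g'', mulRel g g' g'' → tgt g = src g'
  mulRel_src : ∀ g g' g'', mulRel g g' g'' → src g'' = src g
  mulRel_tgt : ∀ g g' g'', mulRel g g' g'' → tgt g'' = tgt g'

namespace Presentation

attribute [instance] Presentation.top Presentation.cg

/-- An interpretation of the generators in a flow `Z` for which all the relations hold. -/
structure Model (P : Presentation.{u}) (Z : Flot.{u}) where
  onState : P.State → Z.State
  onGen : P.Gen → Z.Path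
  continuous_onGen : Continuous onGen
  src_onGen : ∀ g, Z.src (onGen g) = onState (P.src g)
  tgt_onGen : ∀ g, Z.tgt (onGen g) = onState (P.tgt g)
  eqRel : ∀ g g', P.eqRel g g' → onGen g = onGen g'
  mulRel : ∀ g g' g'' (h : Z.tgt (onGen g) = Z.src (onGen g')), P.mulRel g g' g'' →
    Z.comp (onGen g) (onGen g') h = onGen g''

/-- Formal (bracketed) nonempty composites of generators, from a state to a state. -/
inductive Word (P : Presentation.{u}) : P.State → P.State → Type u
  | of (g : P.Gen) : Word P (P.src g) (P.tgt g)
  | mul {a b c : P.State} (v : Word P a b) (w : Word P b c) : Word P a c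

variable {P : Presentation.{u}} {Z : Flot.{u}}

/-- The value of a formal composite in a model. -/
def Model.evalAux (M : P.Model Z) : ∀ {a b : P.State}, P.Word a b →
    {p : Z.Path // Z.src p = M.onState a ∧ Z.tgt p = M.onState b}
  | _, _, .of g => ⟨M.onGen g, M.src_onGen g, M.tgt_onGen g⟩
  | _, _, .mul v w =>
    ⟨Z.comp (M.evalAux v).1 (M.evalAux w).1 ((M.evalAux v).2.2.trans (M.evalAux w).2.1.symm),
      (Z.src_comp _ _ _).trans (M.evalAux v).2.1, (Z.tgt_comp _ _ _).trans (M.evalAux w).2.2⟩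

/-- Two parallel formal composites are identified when they have the same value in every flow in
which the relations hold, that is, when their equality follows from associativity, the relations
and the weak separation axiom. -/
def setoid (P : Presentation.{u}) : Setoid (Σ a b : P.State, P.Word a b) where
  r v w := v.1 = w.1 ∧ v.2.1 = w.2.1 ∧
    ∀ (Z : Flot.{u}) (M : P.Model Z), (M.evalAux v.2.2).1 = (M.evalAux w.2.2).1
  iseqv :=
    { refl := fun _ => ⟨rfl, rfl, fun _ _ => rfl⟩
      symm := fun h => ⟨h.1.symm, h.2.1.symm, fun Z M => (h.2.2 Z M).symm⟩
      trans := fun h h' => ⟨h.1.trans h'.1, h.2.1.trans h'.2.1,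
        fun Z M => (h.2.2 Z M).trans (h'.2.2 Z M)⟩ }

/-- The underlying set of the path space of the presented flow. -/
def PathSpace (P : Presentation.{u}) : Type u := Quotient P.setoid

def PathSpace.src : P.PathSpace → P.State := Quotient.lift (fun v => v.1) fun _ _ h => h.1

def PathSpace.tgt : P.PathSpace → P.State := Quotient.lift (fun v => v.2.1) fun _ _ h => h.2.1

/-- The value of a path of the presented flow in a model. -/
def Model.eval (M : P.Model Z) : P.PathSpace → Z.Path :=
  Quotient.lift (fun v => (M.evalAux v.2.2).1) fun _ _ h => h.2.2 Z M

/-- The coarsest topology for which source, target and evaluation in all models are continuous. -/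
@[reducible]
def coarse (P : Presentation.{u}) : TopologicalSpace P.PathSpace :=
  (TopologicalSpace.induced PathSpace.src ⊥ ⊓ TopologicalSpace.induced PathSpace.tgt ⊥) ⊓
    ⨅ (Z : Flot.{u}) (M : P.Model Z), TopologicalSpace.induced M.eval Z.top

/-- The topology of the path space of the presented flow: the Kelleyfication of `coarse`. -/
instance : TopologicalSpace P.PathSpace := @TopologicalSpace.compactlyGenerated.{u} _ P.coarse

instance : CompactlyGeneratedSpace P.PathSpace := compactlyGeneratedSpace_kelley P.coarse

theorem continuous_src' : Continuous[inferInstance, ⊥] (PathSpace.src (P := P)) :=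
  continuous_le_dom ((kelley_le _).trans (inf_le_left.trans inf_le_left)) continuous_induced_dom

theorem continuous_tgt' : Continuous[inferInstance, ⊥] (PathSpace.tgt (P := P)) :=
  continuous_le_dom ((kelley_le _).trans (inf_le_left.trans inf_le_right)) continuous_induced_dom

theorem Model.continuous_eval (M : P.Model Z) : Continuous M.eval :=
  continuous_le_dom ((kelley_le _).trans (inf_le_right.trans (iInf₂_le Z M)))
    continuous_induced_dom

theorem continuous_to_pathSpace {T : Type u} [TopologicalSpace T] [CompactlyGeneratedSpace T]
    {f : T → P.PathSpace} (hs : Continuous[_, ⊥] fun x => (f x).src)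
    (ht : Continuous[_, ⊥] fun x => (f x).tgt)
    (hM : ∀ (Z : Flot.{u}) (M : P.Model Z), Continuous fun x => M.eval (f x)) :
    Continuous f := by
  refine @continuous_kelley _ _ _ _ P.coarse f ?_
  refine continuous_iff_coinduced_le.2 (le_inf (le_inf ?_ ?_) (le_iInf₂ fun Z M => ?_))
  · exact coinduced_le_iff_le_induced.2 (by rw [induced_compose]; exact hs.le_induced)
  · exact coinduced_le_iff_le_induced.2 (by rw [induced_compose]; exact ht.le_induced)
  · exact coinduced_le_iff_le_induced.2 (by rw [induced_compose]; exact (hM Z M).le_induced)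

theorem PathSpace.ext {x y : P.PathSpace} (hs : x.src = y.src) (ht : x.tgt = y.tgt)
    (hM : ∀ (Z : Flot.{u}) (M : P.Model Z), M.eval x = M.eval y) : x = y := by
  induction x using Quotient.inductionOn with | _ v
  induction y using Quotient.inductionOn with | _ w
  exact Quotient.sound ⟨hs, ht, hM⟩

instance : WeaklyHausdorffSpace P.PathSpace := by
  refine weaklyHausdorff_of_isClosed_eqLocus fun K _ _ _ f g hf hg => ?_
  have key : {k | f k = g k} = ({k | (f k).src = (g k).src} ∩ {k | (f k).tgt = (g k).tgt}) ∩
      ⋂ (Z : Flot.{u}) (M : P.Model Z), {k | M.eval (f k) = M.eval (g k)} := by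
    ext k
    simp only [Set.mem_inter_iff, Set.mem_iInter, Set.mem_ofPred_eq]
    exact ⟨fun h => by simp [h], fun h => PathSpace.ext h.1.1 h.1.2 h.2⟩
  rw [key]
  let _ : TopologicalSpace P.State := ⊥
  have : DiscreteTopology P.State := ⟨rfl⟩
  refine (IsClosed.inter ?_ ?_).inter (isClosed_iInter fun Z => isClosed_iInter fun M => ?_)
  · exact isClosed_eq (continuous_src'.comp hf) (continuous_src'.comp hg)
  · exact isClosed_eq (continuous_tgt'.comp hf) (continuous_tgt'.comp hg)
  · exact isClosed_eqLocus_of_weaklyHausdorff K _ _ (M.continuous_eval.comp hf)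
      (M.continuous_eval.comp hg)

theorem Model.src_eval (M : P.Model Z) (x : P.PathSpace) :
    Z.src (M.eval x) = M.onState x.src := by
  induction x using Quotient.inductionOn with | _ v
  exact (M.evalAux v.2.2).2.1

theorem Model.tgt_eval (M : P.Model Z) (x : P.PathSpace) :
    Z.tgt (M.eval x) = M.onState x.tgt := by
  induction x using Quotient.inductionOn with | _ v
  exact (M.evalAux v.2.2).2.2

/-- Composable paths have a composite, characterised by its source, target and values. -/
theorem exists_comp (x y : P.PathSpace) (h : x.tgt = y.src) :
    ∃ z : P.PathSpace, (z.src = x.src ∧ z.tgt = y.tgt) ∧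
      ∀ (Z : Flot.{u}) (M : P.Model Z) (h' : Z.tgt (M.eval x) = Z.src (M.eval y)),
        M.eval z = Z.comp (M.eval x) (M.eval y) h' := by
  induction x using Quotient.inductionOn with | _ v
  induction y using Quotient.inductionOn with | _ w
  obtain ⟨a, b, v⟩ := v
  obtain ⟨b', c, w⟩ := w
  have h' : b = b' := h
  subst h'
  exact ⟨Quotient.mk _ ⟨a, c, v.mul w⟩, ⟨rfl, rfl⟩, fun _ _ _ => rfl⟩

/-- Composition of paths: the class of the formal composite. -/
noncomputable def PathSpace.comp (x y : P.PathSpace) (h : x.tgt = y.src) : P.PathSpace :=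
  (exists_comp x y h).choose

theorem PathSpace.src_comp (x y : P.PathSpace) (h : x.tgt = y.src) :
    (x.comp y h).src = x.src := (exists_comp x y h).choose_spec.1.1

theorem PathSpace.tgt_comp (x y : P.PathSpace) (h : x.tgt = y.src) :
    (x.comp y h).tgt = y.tgt := (exists_comp x y h).choose_spec.1.2

theorem Model.eval_comp (M : P.Model Z) (x y : P.PathSpace) (h : x.tgt = y.src)
    (h' : Z.tgt (M.eval x) = Z.src (M.eval y)) :
    M.eval (x.comp y h) = Z.comp (M.eval x) (M.eval y) h' :=
  (exists_comp x y h).choose_spec.2 Z M h'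

theorem Model.composable (M : P.Model Z) {x y : P.PathSpace} (h : x.tgt = y.src) :
    Z.tgt (M.eval x) = Z.src (M.eval y) := by
  rw [M.tgt_eval, M.src_eval, h]

/-- The flow presented by generators and relations. -/
noncomputable def flot (P : Presentation.{u}) : Flot.{u} where
  State := P.State
  Path := P.PathSpace
  src := PathSpace.src
  tgt := PathSpace.tgt
  continuous_src := continuous_src'
  continuous_tgt := continuous_tgt'
  comp := PathSpace.comp
  continuous_comp := by
    let E := {p : P.PathSpace × P.PathSpace // p.1.tgt = p.2.src}
    let t₀ : TopologicalSpace E := inferInstance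
    let t : TopologicalSpace E := @TopologicalSpace.compactlyGenerated.{u} E t₀
    have hcg : @CompactlyGeneratedSpace E t := compactlyGeneratedSpace_kelley t₀
    have hfst : Continuous[t, _] fun p : E => p.1.1 :=
      continuous_le_dom (kelley_le t₀)
        (@Continuous.comp _ _ _ t₀ _ _ _ _ continuous_fst continuous_subtype_val)
    have hsnd : Continuous[t, _] fun p : E => p.1.2 :=
      continuous_le_dom (kelley_le t₀)
        (@Continuous.comp _ _ _ t₀ _ _ _ _ continuous_snd continuous_subtype_val)
    refine @continuous_to_pathSpace P E t hcg _ ?_ ?_ ?_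
    · simp only [PathSpace.src_comp]
      exact @Continuous.comp _ _ _ t _ ⊥ _ _ continuous_src' hfst
    · simp only [PathSpace.tgt_comp]
      exact @Continuous.comp _ _ _ t _ ⊥ _ _ continuous_tgt' hsnd
    · intro Z M
      have e : (fun p : E => M.eval (p.1.1.comp p.1.2 p.2)) =
          (fun q : {q : Z.Path × Z.Path // Z.tgt q.1 = Z.src q.2} => Z.comp q.1.1 q.1.2 q.2) ∘
          fun p : E => ⟨(M.eval p.1.1, M.eval p.1.2), M.composable p.2⟩ :=
        funext fun p => M.eval_comp _ _ _ _
      rw [e]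
      refine @Continuous.comp _ _ _ t (TopologicalSpace.compactlyGenerated.{u} _) _ _ _
        Z.continuous_comp ?_
      refine @continuous_kelley _ _ t hcg _ _ ?_
      refine @Continuous.subtype_mk _ _ _ t _ _ ?_ _
      exact @Continuous.prodMk _ _ _ _ _ t _ _
        (@Continuous.comp _ _ _ t _ _ _ _ M.continuous_eval hfst)
        (@Continuous.comp _ _ _ t _ _ _ _ M.continuous_eval hsnd)
  src_comp := PathSpace.src_comp
  tgt_comp := PathSpace.tgt_comp
  comp_assoc x y z h h' := by
    refine PathSpace.ext ?_ ?_ fun Z M => ?_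
    · simp only [PathSpace.src_comp]
    · simp only [PathSpace.tgt_comp]
    · have hxy := M.composable h
      have hyz := M.composable h'
      have h1 : (x.comp y h).tgt = z.src := (PathSpace.tgt_comp x y h).trans h'
      have h2 : x.tgt = (y.comp z h').src := h.trans (PathSpace.src_comp y z h').symm
      refine (M.eval_comp _ _ h1 (M.composable h1)).trans
        (Eq.trans ?_ (M.eval_comp _ _ h2 (M.composable h2)).symm)
      simp only [M.eval_comp _ _ _ hxy, M.eval_comp _ _ _ hyz]
      exact Z.comp_assoc _ _ _ hxy hyz

/-- A generator, as a path of the presented flow. -/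
def gen (P : Presentation.{u}) (g : P.Gen) : P.flot.Path :=
  (Quotient.mk P.setoid ⟨_, _, Word.of g⟩ : P.PathSpace)

@[simp] theorem src_gen (g : P.Gen) : P.flot.src (P.gen g) = P.src g := rfl

@[simp] theorem tgt_gen (g : P.Gen) : P.flot.tgt (P.gen g) = P.tgt g := rfl

theorem continuous_gen (P : Presentation.{u}) : Continuous P.gen :=
  continuous_to_pathSpace (f := P.gen) P.continuous_src P.continuous_tgt
    fun _ M => M.continuous_onGen

theorem gen_eqRel {g g' : P.Gen} (h : P.eqRel g g') : P.gen g = P.gen g' :=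
  PathSpace.ext (P.eqRel_src _ _ h) (P.eqRel_tgt _ _ h) fun _ M => M.eqRel _ _ h

theorem gen_mulRel {g g' g'' : P.Gen} (h : P.mulRel g g' g'')
    (h' : P.flot.tgt (P.gen g) = P.flot.src (P.gen g')) :
    P.flot.comp (P.gen g) (P.gen g') h' = P.gen g'' := by
  refine PathSpace.ext ?_ ?_ fun Z M => ?_
  · exact (P.flot.src_comp _ _ h').trans (P.mulRel_src _ _ _ h).symm
  · exact (P.flot.tgt_comp _ _ h').trans (P.mulRel_tgt _ _ _ h).symm
  · have hc : PathSpace.tgt (P.gen g) = PathSpace.src (P.gen g') := h'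
    exact (M.eval_comp (P.gen g) (P.gen g') hc (M.composable hc)).trans (M.mulRel _ _ _ _ h)

/-- Universal property of the presented flow, existence. -/
def lift (M : P.Model Z) : P.flot ⟶ Z :=
  { onState := M.onState
    onPath := M.eval
    continuous_onPath := M.continuous_eval
    src_onPath := M.src_eval
    tgt_onPath := M.tgt_eval
    onPath_comp := fun x y h => M.eval_comp x y h _ : Hom P.flot Z }

@[simp] theorem lift_onState (M : P.Model Z) (a : P.State) :
    Hom.onState (lift M) a = M.onState a := rfl

@[simp] theorem lift_gen (M : P.Model Z) (g : P.Gen) :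
    Hom.onPath (lift M) (P.gen g) = M.onGen g := rfl

/-- Universal property of the presented flow, uniqueness. -/
theorem flot_hom_ext {f f' : P.flot ⟶ Z}
    (h : ∀ a : P.State, Hom.onState f a = Hom.onState f' a)
    (h' : ∀ g, Hom.onPath f (P.gen g) = Hom.onPath f' (P.gen g)) : f = f' := by
  refine hom_ext h ?_
  have key : ∀ {a b : P.State} (w : P.Word a b),
      Hom.onPath f (Quotient.mk P.setoid ⟨a, b, w⟩ : P.PathSpace) =
        Hom.onPath f' (Quotient.mk P.setoid ⟨a, b, w⟩ : P.PathSpace) := by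
    intro a b w
    induction w with
    | of g => exact h' g
    | @mul a b c v w hv hw =>
      let x : P.PathSpace := Quotient.mk P.setoid ⟨a, b, v⟩
      let y : P.PathSpace := Quotient.mk P.setoid ⟨b, c, w⟩
      have hxy : x.tgt = y.src := rfl
      have e : (Quotient.mk P.setoid ⟨a, c, v.mul w⟩ : P.PathSpace) = P.flot.comp x y hxy :=
        PathSpace.ext (PathSpace.src_comp x y hxy).symm (PathSpace.tgt_comp x y hxy).symm
          fun Z M => (M.eval_comp x y hxy (M.composable hxy)).symm
      rw [e, Hom.onPath_comp f x y hxy, Hom.onPath_comp f' x y hxy]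
      congr 1
  intro x
  obtain ⟨⟨a, b, w⟩, rfl⟩ := Quotient.exists_rep (s := P.setoid) x
  exact key w

end Presentation

/-! ### Pushouts of flows -/

section Pushout

variable {A X Y : Flot.{u}} (f : A ⟶ X) (g : A ⟶ Y)

/-- The amalgamated sum of the sets of states. -/
def PushoutState : Type u :=
  Quot fun a b : X.State ⊕ Y.State =>
    ∃ c : A.State, a = Sum.inl (Hom.onState f c) ∧ b = Sum.inr (Hom.onState g c)

variable {f g} in
def PushoutState.inl (a : X.State) : PushoutState f g := Quot.mk _ (Sum.inl a)

variable {f g} in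
def PushoutState.inr (a : Y.State) : PushoutState f g := Quot.mk _ (Sum.inr a)

theorem PushoutState.glue (c : A.State) :
    (inl (Hom.onState f c) : PushoutState f g) = inr (Hom.onState g c) :=
  Quot.sound ⟨c, rfl, rfl⟩

/-- The presentation of the pushout of `f` and `g` : the generators are the paths of the two flows,
the relations are the compositions in the two flows and the gluing along `A`. -/
def pushoutPresentation : Presentation.{u} where
  State := PushoutState f g
  Gen := X.Path ⊕ Y.Path
  top := inferInstance
  cg := inferInstance
  src := Sum.elim (fun x => .inl (X.src x)) (fun y => .inr (Y.src y))
  tgt := Sum.elim (fun x => .inl (X.tgt x)) (fun y => .inr (Y.tgt y))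
  continuous_src := by
    refine @Continuous.sumElim _ _ _ _ _ ⊥ _ _ ?_ ?_
    · exact @Continuous.comp _ _ _ _ ⊥ ⊥ X.src (fun a => (PushoutState.inl a : PushoutState f g)) continuous_bot X.continuous_src
    · exact @Continuous.comp _ _ _ _ ⊥ ⊥ Y.src (fun a => (PushoutState.inr a : PushoutState f g)) continuous_bot Y.continuous_src
  continuous_tgt := by
    refine @Continuous.sumElim _ _ _ _ _ ⊥ _ _ ?_ ?_
    · exact @Continuous.comp _ _ _ _ ⊥ ⊥ X.tgt (fun a => (PushoutState.inl a : PushoutState f g)) continuous_bot X.continuous_tgt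
    · exact @Continuous.comp _ _ _ _ ⊥ ⊥ Y.tgt (fun a => (PushoutState.inr a : PushoutState f g)) continuous_bot Y.continuous_tgt
  eqRel p q := ∃ a : A.Path, p = Sum.inl (Hom.onPath f a) ∧ q = Sum.inr (Hom.onPath g a)
  mulRel p q r :=
    (∃ (x x' : X.Path) (h : X.tgt x = X.src x'),
      p = Sum.inl x ∧ q = Sum.inl x' ∧ r = Sum.inl (X.comp x x' h)) ∨
    (∃ (y y' : Y.Path) (h : Y.tgt y = Y.src y'),
      p = Sum.inr y ∧ q = Sum.inr y' ∧ r = Sum.inr (Y.comp y y' h))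
  eqRel_src := by
    rintro _ _ ⟨a, rfl, rfl⟩
    simp only [Sum.elim_inl, Sum.elim_inr, Hom.src_onPath, PushoutState.glue]
  eqRel_tgt := by
    rintro _ _ ⟨a, rfl, rfl⟩
    simp only [Sum.elim_inl, Sum.elim_inr, Hom.tgt_onPath, PushoutState.glue]
  mulRel_composable := by
    rintro _ _ _ (⟨x, x', h, rfl, rfl, rfl⟩ | ⟨x, x', h, rfl, rfl, rfl⟩) <;> simp [h]
  mulRel_src := by
    rintro _ _ _ (⟨x, x', h, rfl, rfl, rfl⟩ | ⟨x, x', h, rfl, rfl, rfl⟩) <;>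
      simp [Flot.src_comp]
  mulRel_tgt := by
    rintro _ _ _ (⟨x, x', h, rfl, rfl, rfl⟩ | ⟨x, x', h, rfl, rfl, rfl⟩) <;>
      simp [Flot.tgt_comp]

def pushoutInl : X ⟶ (pushoutPresentation f g).flot :=
  { onState := fun a => (PushoutState.inl a : PushoutState f g)
    onPath := fun x => (pushoutPresentation f g).gen (Sum.inl x)
    continuous_onPath := (pushoutPresentation f g).continuous_gen.comp continuous_inl
    src_onPath := fun _ => rfl
    tgt_onPath := fun _ => rfl
    onPath_comp := fun x y h =>
      (Presentation.gen_mulRel (Or.inl ⟨x, y, h, rfl, rfl, rfl⟩) _).symm : Hom X _ }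

def pushoutInr : Y ⟶ (pushoutPresentation f g).flot :=
  { onState := fun a => (PushoutState.inr a : PushoutState f g)
    onPath := fun x => (pushoutPresentation f g).gen (Sum.inr x)
    continuous_onPath := (pushoutPresentation f g).continuous_gen.comp continuous_inr
    src_onPath := fun _ => rfl
    tgt_onPath := fun _ => rfl
    onPath_comp := fun x y h =>
      (Presentation.gen_mulRel (Or.inr ⟨x, y, h, rfl, rfl, rfl⟩) _).symm : Hom Y _ }

variable {f g}

def pushoutModel {Z : Flot.{u}} (p : X ⟶ Z) (q : Y ⟶ Z) (w : f ≫ p = g ≫ q) :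
    (pushoutPresentation f g).Model Z where
  onState := Quot.lift (Sum.elim (Hom.onState p) (Hom.onState q)) (by
    rintro _ _ ⟨c, rfl, rfl⟩
    exact congrFun (congrArg Hom.onState w) c)
  onGen := Sum.elim (Hom.onPath p) (Hom.onPath q)
  continuous_onGen := p.continuous_onPath.sumElim q.continuous_onPath
  src_onGen := by
    rintro (x | y)
    · exact p.src_onPath x
    · exact q.src_onPath y
  tgt_onGen := by
    rintro (x | y)
    · exact p.tgt_onPath x
    · exact q.tgt_onPath y
  eqRel := by
    rintro _ _ ⟨a, rfl, rfl⟩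
    exact congrFun (congrArg Hom.onPath w) a
  mulRel := by
    rintro _ _ _ h (⟨x, x', h', rfl, rfl, rfl⟩ | ⟨x, x', h', rfl, rfl, rfl⟩)
    · exact (p.onPath_comp x x' h').symm
    · exact (q.onPath_comp x x' h').symm

theorem isPushout_presentation (f : A ⟶ X) (g : A ⟶ Y) :
    IsPushout f g (pushoutInl f g) (pushoutInr f g) where
  w := hom_ext (fun a => PushoutState.glue f g a)
    fun x => Presentation.gen_eqRel ⟨x, rfl, rfl⟩
  isColimit' := ⟨PushoutCocone.IsColimit.mk _
    (fun s => Presentation.lift (pushoutModel s.inl s.inr s.condition))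
    (fun _ => rfl) (fun _ => rfl)
    (fun s m h h' => Presentation.flot_hom_ext
      (by
        rintro ⟨a | a⟩
        · exact congrFun (congrArg Hom.onState h) a
        · exact congrFun (congrArg Hom.onState h') a)
      (by
        rintro (x | x)
        · exact congrFun (congrArg Hom.onPath h) x
        · exact congrFun (congrArg Hom.onPath h') x))⟩

instance : HasPushouts Flot.{u} :=
  have (A X Y : Flot.{u}) (f : A ⟶ X) (g : A ⟶ Y) : HasColimit (span f g) :=
    (isPushout_presentation f g).hasPushout
  hasPushouts_of_hasColimit_span _

end Pushout

/-! ### The flow `U ⊠ X` -/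

/-- Generators and relations for `U ⊠ X`: the states are those of `X`, the generators are
the points of the compactly generated product `U × ℙX`, with `s(u, x) = s(x)`, `t(u, x) = t(x)`,
and the relations are `(u, x) * (u, y) = (u, x * y)`. -/
def boxPresentation (U : Type u) [TopologicalSpace U] (X : Flot.{u}) : Presentation.{u} where
  State := X.State
  Gen := U × X.Path
  top := TopologicalSpace.compactlyGenerated.{u} (U × X.Path)
  cg := compactlyGeneratedSpace_kelley _
  src p := X.src p.2
  tgt p := X.tgt p.2
  continuous_src := continuous_le_dom (kelley_le _)
    (@Continuous.comp _ _ _ _ _ ⊥ _ _ X.continuous_src continuous_snd)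
  continuous_tgt := continuous_le_dom (kelley_le _)
    (@Continuous.comp _ _ _ _ _ ⊥ _ _ X.continuous_tgt continuous_snd)
  eqRel _ _ := False
  mulRel p q r := ∃ (u : U) (x y : X.Path) (h : X.tgt x = X.src y),
    p = (u, x) ∧ q = (u, y) ∧ r = (u, X.comp x y h)
  eqRel_src _ _ := False.elim
  eqRel_tgt _ _ := False.elim
  mulRel_composable := by
    rintro _ _ _ ⟨u, x, y, h, rfl, rfl, rfl⟩
    exact h
  mulRel_src := by
    rintro _ _ _ ⟨u, x, y, h, rfl, rfl, rfl⟩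
    exact X.src_comp x y h
  mulRel_tgt := by
    rintro _ _ _ ⟨u, x, y, h, rfl, rfl, rfl⟩
    exact X.tgt_comp x y h

/-- The flow `U ⊠ X`. -/
noncomputable def box (U : Type u) [TopologicalSpace U] (X : Flot.{u}) : Flot.{u} :=
  (boxPresentation U X).flot

/-- The path `u ⊠ x` of `U ⊠ X`. -/
def boxMk {U : Type u} [TopologicalSpace U] {X : Flot.{u}} (u : U) (x : X.Path) :
    (box U X).Path :=
  (boxPresentation U X).gen (u, x)

theorem boxMk_comp {U : Type u} [TopologicalSpace U] {X : Flot.{u}} (u : U) (x y : X.Path)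
    (h : X.tgt x = X.src y) (h' : (box U X).tgt (boxMk u x) = (box U X).src (boxMk u y)) :
    (box U X).comp (boxMk u x) (boxMk u y) h' = boxMk u (X.comp x y h) :=
  Presentation.gen_mulRel (P := boxPresentation U X) ⟨u, x, y, h, rfl, rfl, rfl⟩ h'

/-- The maps out of `box U X` given by a map on states and a continuous map on the compactly
generated product `U × ℙX` that respect source, target and composition for each fixed `u`. -/
noncomputable def boxLift {U : Type u} [TopologicalSpace U] {X Z : Flot.{u}}
    (φ₀ : X.State → Z.State)
    (φ : U → X.Path → Z.Path)
    (hφ : Continuous[TopologicalSpace.compactlyGenerated.{u} (U × X.Path), _]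
      fun p : U × X.Path => φ p.1 p.2)
    (hs : ∀ u x, Z.src (φ u x) = φ₀ (X.src x)) (ht : ∀ u x, Z.tgt (φ u x) = φ₀ (X.tgt x))
    (hc : ∀ u x y (h : X.tgt x = X.src y) (h' : Z.tgt (φ u x) = Z.src (φ u y)),
      Z.comp (φ u x) (φ u y) h' = φ u (X.comp x y h)) : box U X ⟶ Z :=
  Presentation.lift (P := boxPresentation U X)
    { onState := φ₀
      onGen := fun p => φ p.1 p.2
      continuous_onGen := hφ
      src_onGen := fun p => hs p.1 p.2
      tgt_onGen := fun p => ht p.1 p.2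
      eqRel := fun _ _ h => h.elim
      mulRel := by
        rintro _ _ _ h' ⟨u, x, y, h, rfl, rfl, rfl⟩
        exact hc u x y h h' }

theorem continuous_boxMk {U : Type u} [TopologicalSpace U] {X : Flot.{u}} :
    Continuous[TopologicalSpace.compactlyGenerated.{u} (U × X.Path), _]
      fun p : U × X.Path => boxMk (X := X) p.1 p.2 :=
  (boxPresentation U X).continuous_gen

/-- Functoriality of `⊠` : the morphism `(u, x) ↦ (φ u, f x)`. -/
noncomputable def boxMap {U V : Type u} [TopologicalSpace U] [TopologicalSpace V] (φ : C(U, V))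
    {X Y : Flot.{u}} (f : X ⟶ Y) : box U X ⟶ box V Y :=
  boxLift (Z := box V Y) f.onState (fun u x => boxMk (φ u) (Hom.onPath f x))
    (by
      let t : TopologicalSpace (U × X.Path) := TopologicalSpace.compactlyGenerated.{u} (U × X.Path)
      have hcg : @CompactlyGeneratedSpace (U × X.Path) t := compactlyGeneratedSpace_kelley _
      refine @Continuous.comp _ _ _ t (TopologicalSpace.compactlyGenerated.{u} (V × Y.Path)) _
        (fun p => (φ p.1, Hom.onPath f p.2)) (fun p : V × Y.Path => boxMk (X := Y) p.1 p.2)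
        continuous_boxMk ?_
      refine @continuous_kelley _ _ t hcg _ _ (continuous_le_dom (kelley_le _) ?_)
      exact φ.continuous.prodMap f.continuous_onPath)
    (fun _ x => f.src_onPath x) (fun _ x => f.tgt_onPath x)
    (fun u x y h h' => by rw [f.onPath_comp]; exact boxMk_comp _ _ _ _ _)

/-- The morphism `u ⊠ - : X ⟶ U ⊠ X`, which sends a path `x` to `u ⊠ x` and a state to
itself. -/
def boxIn {U : Type u} [TopologicalSpace U] (u : U) (X : Flot.{u}) : X ⟶ box U X :=
  { onState := id
    onPath := boxMk u
    continuous_onPath := by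
      refine @Continuous.comp _ _ _ _ (TopologicalSpace.compactlyGenerated.{u} (U × X.Path)) _
        (fun x => (u, x)) (fun p : U × X.Path => boxMk (X := X) p.1 p.2) continuous_boxMk ?_
      exact continuous_kelley (by fun_prop)
    src_onPath := fun _ => rfl
    tgt_onPath := fun _ => rfl
    onPath_comp := fun x y h => (boxMk_comp u x y h _).symm : Hom X (box U X) }

theorem box_hom_ext {U : Type u} [TopologicalSpace U] {X Z : Flot.{u}} {f g : box U X ⟶ Z}
    (h : ∀ a : X.State, Hom.onState f a = Hom.onState g a)
    (h' : ∀ (u : U) (x : X.Path), Hom.onPath f (boxMk u x) = Hom.onPath g (boxMk u x)) : f = g :=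
  Presentation.flot_hom_ext (P := boxPresentation U X) h fun p => h' p.1 p.2

/-! ### S-homotopies and S-cofibrations -/

/-- S-homotopy of morphisms: a family of morphisms `H u`, `u ∈ [0, 1]`, which is continuous as a
map `X × [0, 1] → Y` (on states and on paths). -/
def SHomotopic {X Y : Flot.{u}} (f g : X ⟶ Y) : Prop :=
  ∃ H : unitInterval → (X ⟶ Y),
    (Continuous fun p : X.State × unitInterval => Hom.onState (H p.2) p.1) ∧
    (Continuous fun p : X.Path × unitInterval => Hom.onPath (H p.2) p.1) ∧
    H 0 = f ∧ H 1 = g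

/-- `f` is an S-homotopy equivalence. -/
def IsSHomotopyEquiv {X Y : Flot.{u}} (f : X ⟶ Y) : Prop :=
  ∃ g : Y ⟶ X, SHomotopic (g ≫ f) (𝟙 Y) ∧ SHomotopic (f ≫ g) (𝟙 X)

/-- The unit interval, as a space in the universe under consideration. -/
abbrev Interval : Type u := ULift.{u} unitInterval

/-- S-cofibrations: morphisms with the S-homotopy extension property. -/
def IsSCofibration {X Y : Flot.{u}} (i : X ⟶ Y) : Prop :=
  ∀ (Z : Flot.{u}) (g : Y ⟶ Z) (H : box Interval.{u} X ⟶ Z),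
    boxIn (ULift.up 0) X ≫ H = i ≫ g →
    ∃ H' : box Interval.{u} Y ⟶ Z,
      (∀ t : Interval.{u}, i ≫ boxIn t Y ≫ H' = boxIn t X ≫ H) ∧
      boxIn (ULift.up 0) Y ≫ H' = g

/-- Acyclic S-cofibrations. -/
def IsAcyclicSCofibration {X Y : Flot.{u}} (i : X ⟶ Y) : Prop :=
  IsSCofibration i ∧ IsSHomotopyEquiv i

/-! ### The morphism `(Y, B) ⊠ i` -/

/-- The inclusion of a subspace. -/
def subspaceIncl {Y : Type u} [TopologicalSpace Y] (B : Set Y) : C(B, Y) :=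
  ⟨Subtype.val, continuous_subtype_val⟩

/-- The canonical morphism `Y ⊠ A ⊔_{B ⊠ A} B ⊠ X ⟶ Y ⊠ X`. -/
noncomputable def pushoutBox {Y : Type u} [TopologicalSpace Y] (B : Set Y) {A X : Flot.{u}}
    (i : A ⟶ X) :
    pushout (boxMap (subspaceIncl B) (𝟙 A)) (boxMap (ContinuousMap.id B) i) ⟶ box Y X :=
  pushout.desc (boxMap (ContinuousMap.id Y) i) (boxMap (subspaceIncl B) (𝟙 X))
    (box_hom_ext (fun _ => rfl) fun _ _ => rfl)

end Flot

/-! ### NDR pairs and DR pairs -/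

/-- `(u, h)` represents `(Y, B)` as a neighbourhood deformation retract pair. -/
structure RepresentsNDR {Y : Type u} [TopologicalSpace Y] (B : Set Y) (u : C(Y, unitInterval))
    (h : C(unitInterval × Y, Y)) : Prop where
  zero_set : B = u ⁻¹' {0}
  h_zero : ∀ y, h (0, y) = y
  h_fix : ∀ t, ∀ b ∈ B, h (t, b) = b
  h_one : ∀ y, u y < 1 → h (1, y) ∈ B

/-- `(Y, B)` is an NDR pair. -/
def IsNDRPair (Y : Type u) [TopologicalSpace Y] (B : Set Y) : Prop :=
  ∃ (u : C(Y, unitInterval)) (h : C(unitInterval × Y, Y)), RepresentsNDR B u h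

/-- `(Y, B)` is a DR pair: an NDR pair for which the deformation takes all of `Y` into `B`. -/
def IsDRPair (Y : Type u) [TopologicalSpace Y] (B : Set Y) : Prop :=
  ∃ (u : C(Y, unitInterval)) (h : C(unitInterval × Y, Y)),
    RepresentsNDR B u h ∧ ∀ y, h (1, y) ∈ B

/-! By adjunction, a morphism `W ⊠ X ⟶ Z` is the same as a family of morphisms `X ⟶ Z` indexed by
`W`, with one common map on states and continuous on compact Hausdorff test spaces
(`IsFamily.desc`). It is also the same as one morphism from `X` to the flow of maps `power W Z`
(`IsFamily.toPower`). Families therefore transfer to `W ⊠ X` and to pushouts without any analysis of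
the composites of generators that make up their path spaces (`IsFamily.exists_box`,
`IsFamily.exists_pushout`). Applying the homotopy extension property with target `power W Z` gives
the same property with parameters in `W` (`IsSCofibration.exists_family`).

In these terms, homotopy extension for `(Y, B) ⊠ i` is an extension problem for families indexed by
`[0, 1] × Y`. The morphisms are prescribed on `A` everywhere, and on `X` over `M = {0} × Y ∪ [0, 1]
× B`. For an NDR pair, `([0, 1] × Y, M)` is a retract of `([0, 1] × P, {0} × P)` with `P = [0, 1] ×
Y` (`RepresentsNDR.exists_retract`). The problem thus reduces to homotopy extension along `i` with
parameters in `P` (`IsSCofibration.exists_extension`).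

For acyclicity, an inverse is built from a deformation that is constant on the glued part. For a DR
pair this is the deformation of `Y` onto `B`, which fixes `B`. For acyclic `i` it is a deformation
of `X` onto `A` that fixes `A`, supplied by `IsAcyclicSCofibration.exists_deformation`. In both
cases the constant homotopy on the other summand completes it to a homotopy on the pushout. -/

/-! ### Continuity on compact Hausdorff test spaces -/

/-- A map is k-continuous if its composite with every continuous map from a compact Hausdorff space
is continuous, that is, if it is continuous for the Kelleyfication of the topology of its domain. -/
def KContinuous {X Z : Type u} [TopologicalSpace X] [TopologicalSpace Z] (f : X → Z) : Prop :=
  ∀ (K : Type u) [TopologicalSpace K] [CompactSpace K] [T2Space K] (c : K → X),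
    Continuous c → Continuous fun k => f (c k)

namespace KContinuous

variable {X Y Z : Type u} [TopologicalSpace X] [TopologicalSpace Y] [TopologicalSpace Z]

theorem continuous_compactlyGenerated {f : X → Z} (hf : KContinuous f) :
    Continuous[TopologicalSpace.compactlyGenerated.{u} X, _] f :=
  continuous_from_compactlyGenerated f fun S g => hf S g g.2

theorem of_continuous_compactlyGenerated {f : X → Z}
    (hf : Continuous[TopologicalSpace.compactlyGenerated.{u} X, _] f) : KContinuous f := by
  intro K _ _ _ c hc
  exact @Continuous.comp _ _ _ _ (TopologicalSpace.compactlyGenerated.{u} X) _ c f hf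
    (continuous_kelley hc)

theorem _root_.Continuous.kContinuous {f : X → Z} (hf : Continuous f) : KContinuous f :=
  fun _ _ _ _ _ hc => hf.comp hc

theorem continuous [CompactlyGeneratedSpace X] {f : X → Z} (hf : KContinuous f) :
    Continuous f :=
  continuous_from_compactlyGeneratedSpace f fun K _ _ _ g hg => hf K g hg

theorem comp {g : Y → Z} {f : X → Y} (hg : KContinuous g) (hf : KContinuous f) :
    KContinuous fun x => g (f x) :=
  fun K _ _ _ c hc => hg K (fun k => f (c k)) (hf K c hc)

theorem prodMk {f : X → Y} {g : X → Z} (hf : KContinuous f) (hg : KContinuous g) :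
    KContinuous fun x => (f x, g x) :=
  fun K _ _ _ c hc => (hf K c hc).prodMk (hg K c hc)

theorem fst {f : X → Y × Z} (hf : KContinuous f) : KContinuous fun x => (f x).1 :=
  continuous_fst.kContinuous.comp hf

theorem snd {f : X → Y × Z} (hf : KContinuous f) : KContinuous fun x => (f x).2 :=
  continuous_snd.kContinuous.comp hf

theorem subtypeMk {p : Y → Prop} {f : X → Y} (hf : KContinuous f) (h : ∀ x, p (f x)) :
    KContinuous fun x => (⟨f x, h x⟩ : Subtype p) :=
  fun K _ _ _ c hc => (hf K c hc).subtype_mk _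

/-- k-continuity is local for finite closed covers. -/
theorem of_isClosed_union {f : X → Z} {s t : Set X} (hs : IsClosed s) (ht : IsClosed t)
    (hst : ∀ x, x ∈ s ∨ x ∈ t) (h₁ : KContinuous fun x : s => f x)
    (h₂ : KContinuous fun x : t => f x) : KContinuous f := by
  intro K _ _ _ c hc
  have key : ∀ (r : Set X), IsClosed r → (KContinuous fun x : r => f x) →
      ContinuousOn (fun k => f (c k)) (c ⁻¹' r) := by
    intro r hr h
    rw [continuousOn_iff_continuous_domRestrict]
    -- A closed subset of a test space is again a test space.
    have : CompactSpace (c ⁻¹' r) := isCompact_iff_compactSpace.1 (hr.preimage hc).isCompact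
    exact h (c ⁻¹' r) (fun k => ⟨c k.1, k.2⟩) (by fun_prop)
  rw [← continuousOn_univ, ← (by ext k; simpa using hst (c k) : c ⁻¹' s ∪ c ⁻¹' t = Set.univ)]
  exact (key s hs h₁).union_of_isClosed (key t ht h₂) (hs.preimage hc) (ht.preimage hc)

/-- A k-continuous map on the product of a compactly generated space and a compact Hausdorff space
is continuous. -/
theorem continuous_prod [CompactlyGeneratedSpace X] [CompactSpace Y] [T2Space Y] {f : X × Y → Z}
    (hf : KContinuous f) : Continuous f := by
  have h : ∀ x, Continuous fun y => f (x, y) := fun x => hf Y (fun y => (x, y)) (by fun_prop)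
  -- The curried map into `C(Y, Z)` has source `X` alone, so its continuity can be checked on test
  -- spaces. Evaluation is jointly continuous because `Y` is locally compact.
  have h' : Continuous fun x => (⟨fun y => f (x, y), h x⟩ : C(Y, Z)) := by
    refine KContinuous.continuous fun K _ _ _ c hc => ?_
    exact (ContinuousMap.curry ⟨fun p : K × Y => f (c p.1, p.2),
      hf (K × Y) (fun p => (c p.1, p.2)) (by fun_prop)⟩).continuous
  exact ContinuousEval.continuous_eval.comp (h'.prodMap continuous_id)

end KContinuous

namespace Flot

/-! ### Families of morphisms of flows -/

/-- A family of morphisms of flows `X ⟶ Z` parametrised by a space `W`, all with the same map on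
states and k-continuous in the parameter and the path. -/
structure IsFamily {W : Type u} [TopologicalSpace W] {X Z : Flot.{u}} (φ₀ : X.State → Z.State)
    (φ : W → (X ⟶ Z)) : Prop where
  onState : ∀ w, Hom.onState (φ w) = φ₀
  kContinuous : KContinuous fun p : W × X.Path => Hom.onPath (φ p.1) p.2

section Family

variable {V W : Type u} [TopologicalSpace V] [TopologicalSpace W] {X Y Z : Flot.{u}}

theorem IsFamily.congrState {φ₀ φ₀' : X.State → Z.State} {φ : W → (X ⟶ Z)} (hφ : IsFamily φ₀ φ)
    (h : φ₀ = φ₀') : IsFamily φ₀' φ :=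
  h ▸ hφ

theorem isFamily_const (f : X ⟶ Z) : IsFamily (Hom.onState f) fun _ : W => f :=
  ⟨fun _ => rfl, (f.continuous_onPath.comp continuous_snd).kContinuous⟩

theorem IsFamily.comp {φ₀ : X.State → Y.State} {φ : W → (X ⟶ Y)} {ψ₀ : Y.State → Z.State}
    {ψ : W → (Y ⟶ Z)} (hφ : IsFamily φ₀ φ) (hψ : IsFamily ψ₀ ψ) :
    IsFamily (ψ₀ ∘ φ₀) fun w => φ w ≫ ψ w where
  onState w := by rw [comp_onState, hφ.onState, hψ.onState]
  kContinuous := hψ.kContinuous.comp (continuous_fst.kContinuous.prodMk hφ.kContinuous)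

theorem IsFamily.compConst {φ₀ : X.State → Y.State} {φ : W → (X ⟶ Y)} (hφ : IsFamily φ₀ φ)
    (g : Y ⟶ Z) : IsFamily (Hom.onState g ∘ φ₀) fun w => φ w ≫ g :=
  hφ.comp (isFamily_const g)

theorem IsFamily.constComp {ψ₀ : Y.State → Z.State} {ψ : W → (Y ⟶ Z)} (f : X ⟶ Y)
    (hψ : IsFamily ψ₀ ψ) : IsFamily (ψ₀ ∘ Hom.onState f) fun w => f ≫ ψ w :=
  (isFamily_const f).comp hψ

theorem IsFamily.reparam {φ₀ : X.State → Z.State} {φ : W → (X ⟶ Z)} (hφ : IsFamily φ₀ φ)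
    {c : V → W} (hc : KContinuous c) : IsFamily φ₀ fun v => φ (c v) where
  onState v := hφ.onState (c v)
  kContinuous := hφ.kContinuous.comp
    ((hc.comp continuous_fst.kContinuous).prodMk continuous_snd.kContinuous)

/-- This is the universal family: with `IsFamily.desc`, it makes `W ⊠ X` represent families indexed
by `W`. -/
theorem isFamily_boxIn : IsFamily (Z := box W X) (id : X.State → X.State) fun w : W => boxIn w X :=
  ⟨fun _ => rfl, .of_continuous_compactlyGenerated continuous_boxMk⟩

theorem isFamily_boxIn_comp (f : box W X ⟶ Z) :
    IsFamily (X := X) (Hom.onState (X := box W X) f) fun w : W => boxIn w X ≫ f :=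
  isFamily_boxIn.compConst f

/-- The morphism `W ⊠ X ⟶ Z` that corresponds to a family. -/
noncomputable def IsFamily.desc {φ₀ : X.State → Z.State} {φ : W → (X ⟶ Z)} (hφ : IsFamily φ₀ φ) :
    box W X ⟶ Z :=
  boxLift φ₀ (fun w x => Hom.onPath (φ w) x) hφ.kContinuous.continuous_compactlyGenerated
    (fun w x => by rw [Hom.src_onPath, hφ.onState])
    (fun w x => by rw [Hom.tgt_onPath, hφ.onState])
    (fun w x y h _ => (Hom.onPath_comp (φ w) x y h).symm)

theorem IsFamily.boxIn_desc {φ₀ : X.State → Z.State} {φ : W → (X ⟶ Z)} (hφ : IsFamily φ₀ φ)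
    (w : W) : boxIn w X ≫ hφ.desc = φ w :=
  hom_ext (fun a => (congrFun (hφ.onState w) a).symm) fun _ => rfl

/-- The condition on states is separate because the one on points of `W` is vacuous when `W` is
empty. -/
theorem box_hom_ext_boxIn {f g : box W X ⟶ Z}
    (h : Hom.onState (X := box W X) f = Hom.onState (X := box W X) g)
    (h' : ∀ w : W, boxIn w X ≫ f = boxIn w X ≫ g) : f = g :=
  box_hom_ext (congrFun h) fun w x => congrFun (congrArg Hom.onPath (h' w)) x

end Family

/-! ### The flow of maps from a space to a flow -/

section Power

variable (W : Type u) [TopologicalSpace W] (Z : Flot.{u})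

/-- A path of the flow of maps from `W` to `Z`: a k-continuous map from `W` to a space of paths
of `Z` with fixed source and target. -/
@[ext]
structure PowerPath : Type u where
  -- The endpoints are part of the data: for empty `W` the function does not determine them.
  src : Z.State
  tgt : Z.State
  toFun : W → Z.Path
  kContinuous : KContinuous toFun
  src_toFun : ∀ w, Z.src (toFun w) = src
  tgt_toFun : ∀ w, Z.tgt (toFun w) = tgt

namespace PowerPath

variable {W Z}

/-- The restriction along a map from a compact Hausdorff space. -/
def restrict (L : CompHaus.{u}) (c : C(L, W)) (p : PowerPath W Z) : C(L, Z.Path) :=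
  ⟨fun l => p.toFun (c l), p.kContinuous L c c.2⟩

/-- The topology of uniform convergence on compact Hausdorff test spaces. -/
@[reducible]
def coarse (W : Type u) [TopologicalSpace W] (Z : Flot.{u}) : TopologicalSpace (PowerPath W Z) :=
  (TopologicalSpace.induced PowerPath.src ⊥ ⊓ TopologicalSpace.induced PowerPath.tgt ⊥) ⊓
    ⨅ (L : CompHaus.{u}) (c : C(L, W)), TopologicalSpace.induced (restrict L c) inferInstance

instance : TopologicalSpace (PowerPath W Z) :=
  @TopologicalSpace.compactlyGenerated.{u} _ (coarse W Z)

instance : CompactlyGeneratedSpace (PowerPath W Z) := compactlyGeneratedSpace_kelley _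

theorem continuous_src : Continuous[inferInstance, ⊥] (src (W := W) (Z := Z)) :=
  continuous_le_dom ((kelley_le _).trans (inf_le_left.trans inf_le_left)) continuous_induced_dom

theorem continuous_tgt : Continuous[inferInstance, ⊥] (tgt (W := W) (Z := Z)) :=
  continuous_le_dom ((kelley_le _).trans (inf_le_left.trans inf_le_right)) continuous_induced_dom

theorem continuous_restrict (L : CompHaus.{u}) (c : C(L, W)) :
    Continuous (restrict (Z := Z) L c) :=
  continuous_le_dom ((kelley_le _).trans (inf_le_right.trans (iInf₂_le L c)))
    continuous_induced_dom

/-- A test map `K → PowerPath W Z × W` has a second component `K → W`. Restriction along it gives a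
continuous map `K → C(K, Z.Path)`, to be evaluated on the diagonal. -/
theorem kContinuous_eval : KContinuous fun p : PowerPath W Z × W => p.1.toFun p.2 := by
  intro K _ _ _ c hc
  have h := (continuous_restrict (Z := Z) (CompHaus.of K) ⟨fun k => (c k).2, hc.snd⟩).comp hc.fst
  exact ContinuousEval.continuous_eval.comp (h.prodMk continuous_id)

/-- This is the exponential law, the converse of `kContinuous_eval`. For test spaces `K` of `T` and
`L` of `W`, the product `K × L` is a test space of `T × W`, and currying over it gives the
continuity of each restriction. -/
theorem continuous_mk {T : Type u} [TopologicalSpace T] [CompactlyGeneratedSpace T]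
    {f : T → PowerPath W Z} (hs : Continuous[_, ⊥] fun x => (f x).src)
    (ht : Continuous[_, ⊥] fun x => (f x).tgt)
    (hf : KContinuous fun p : T × W => (f p.1).toFun p.2) : Continuous f := by
  refine @continuous_kelley _ _ _ _ (coarse W Z) f ?_
  refine continuous_iff_coinduced_le.2 (le_inf (le_inf ?_ ?_) (le_iInf₂ fun L c => ?_))
  · exact coinduced_le_iff_le_induced.2 (by rw [induced_compose]; exact hs.le_induced)
  · exact coinduced_le_iff_le_induced.2 (by rw [induced_compose]; exact ht.le_induced)
  · refine coinduced_le_iff_le_induced.2 ?_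
    rw [induced_compose]
    refine Continuous.le_induced (KContinuous.continuous fun K _ _ _ d hd => ?_)
    have h : Continuous fun p : K × L => (f (d p.1)).toFun (c p.2) :=
      hf (K × L) (fun p => (d p.1, c p.2)) (by fun_prop)
    exact (ContinuousMap.curry ⟨_, h⟩).continuous

instance : WeaklyHausdorffSpace (PowerPath W Z) := by
  refine weaklyHausdorff_of_isClosed_eqLocus fun K _ _ _ f g hf hg => ?_
  have key : {k | f k = g k} = ({k | (f k).src = (g k).src} ∩ {k | (f k).tgt = (g k).tgt}) ∩
      ⋂ w : W, {k | (f k).toFun w = (g k).toFun w} := by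
    ext k
    simp only [Set.mem_inter_iff, Set.mem_iInter, Set.mem_ofPred_eq]
    exact ⟨fun h => by simp [h], fun h => PowerPath.ext h.1.1 h.1.2 (funext h.2)⟩
  rw [key]
  refine (IsClosed.inter ?_ ?_).inter (isClosed_iInter fun w => ?_)
  · exact isClosed_eq (continuous_src.comp hf) (continuous_src.comp hg)
  · exact isClosed_eq (continuous_tgt.comp hf) (continuous_tgt.comp hg)
  · exact isClosed_eqLocus_of_weaklyHausdorff K _ _
      (kContinuous_eval K (fun k => (f k, w)) (by fun_prop))
      (kContinuous_eval K (fun k => (g k, w)) (by fun_prop))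

/-- Pointwise composition. -/
def comp (p q : PowerPath W Z) (h : p.tgt = q.src) : PowerPath W Z where
  src := p.src
  tgt := q.tgt
  toFun w := Z.comp (p.toFun w) (q.toFun w) (by rw [p.tgt_toFun, q.src_toFun, h])
  kContinuous := (KContinuous.of_continuous_compactlyGenerated Z.continuous_comp).comp
    ((p.kContinuous.prodMk q.kContinuous).subtypeMk
      fun w => by rw [p.tgt_toFun, q.src_toFun, h])
  src_toFun w := by rw [Z.src_comp, p.src_toFun]
  tgt_toFun w := by rw [Z.tgt_comp, q.tgt_toFun]

end PowerPath

/-- The flow of maps from `W` to `Z`, right adjoint to `W ⊠ -`. -/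
def power : Flot.{u} where
  State := Z.State
  Path := PowerPath W Z
  src := PowerPath.src
  tgt := PowerPath.tgt
  continuous_src := PowerPath.continuous_src
  continuous_tgt := PowerPath.continuous_tgt
  comp := PowerPath.comp
  continuous_comp := by
    let f : {p : PowerPath W Z × PowerPath W Z // p.1.tgt = p.2.src} → PowerPath W Z :=
      fun p => p.1.1.comp p.1.2 p.2
    refine KContinuous.continuous_compactlyGenerated (f := f) fun K _ _ _ c hc => ?_
    have h₁ : Continuous fun k => (c k).1.1 := by fun_prop
    have h₂ : Continuous fun k => (c k).1.2 := by fun_prop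
    have hs : Continuous[_, ⊥] fun k => (c k).1.1.src := PowerPath.continuous_src.comp h₁
    have ht : Continuous[_, ⊥] fun k => (c k).1.2.tgt := PowerPath.continuous_tgt.comp h₂
    refine PowerPath.continuous_mk (f := fun k => f (c k)) hs ht ?_
    have h₁' : KContinuous fun p : K × W => (c p.1).1.1.toFun p.2 :=
      PowerPath.kContinuous_eval.comp (f := fun p : K × W => ((c p.1).1.1, p.2))
        (Continuous.kContinuous (by fun_prop))
    have h₂' : KContinuous fun p : K × W => (c p.1).1.2.toFun p.2 :=
      PowerPath.kContinuous_eval.comp (f := fun p : K × W => ((c p.1).1.2, p.2))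
        (Continuous.kContinuous (by fun_prop))
    exact (KContinuous.of_continuous_compactlyGenerated Z.continuous_comp).comp
      ((h₁'.prodMk h₂').subtypeMk fun p => by
        rw [PowerPath.tgt_toFun, PowerPath.src_toFun, (c p.1).2])
  src_comp _ _ _ := rfl
  tgt_comp _ _ _ := rfl
  comp_assoc x y z h h' := PowerPath.ext rfl rfl (funext fun w => Z.comp_assoc _ _ _ _ _)

variable {W Z} {X : Flot.{u}}

/-- The transpose of a family. -/
def IsFamily.toPower {φ₀ : X.State → Z.State} {φ : W → (X ⟶ Z)} (hφ : IsFamily φ₀ φ) :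
    X ⟶ power W Z :=
  { onState := φ₀
    onPath := fun x =>
      { src := φ₀ (X.src x)
        tgt := φ₀ (X.tgt x)
        toFun := fun w => Hom.onPath (φ w) x
        kContinuous := hφ.kContinuous.comp (continuous_id.prodMk continuous_const).kContinuous
        src_toFun := fun w => by rw [Hom.src_onPath, hφ.onState]
        tgt_toFun := fun w => by rw [Hom.tgt_onPath, hφ.onState] }
    continuous_onPath := PowerPath.continuous_mk
      (@Continuous.comp _ _ _ _ ⊥ ⊥ X.src φ₀ continuous_bot X.continuous_src)
      (@Continuous.comp _ _ _ _ ⊥ ⊥ X.tgt φ₀ continuous_bot X.continuous_tgt)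
      (hφ.kContinuous.comp continuous_swap.kContinuous)
    src_onPath := fun _ => rfl
    tgt_onPath := fun _ => rfl
    onPath_comp := fun x y h => PowerPath.ext (congrArg φ₀ (X.src_comp x y h))
      (congrArg φ₀ (X.tgt_comp x y h)) (funext fun w => Hom.onPath_comp (φ w) x y h) :
    Hom X (power W Z) }

/-- Evaluation at a point. -/
def powerEval (w : W) : power W Z ⟶ Z :=
  { onState := id
    onPath := fun p => p.toFun w
    continuous_onPath :=
      (PowerPath.kContinuous_eval.comp (f := fun p : PowerPath W Z => (p, w))
        (Continuous.kContinuous (by fun_prop))).continuous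
    src_onPath := fun p => p.src_toFun w
    tgt_onPath := fun p => p.tgt_toFun w
    onPath_comp := fun _ _ _ => rfl : Hom (power W Z) Z }

theorem isFamily_powerEval : IsFamily (X := power W Z) (id : Z.State → Z.State)
    fun w : W => powerEval w :=
  ⟨fun _ => rfl, PowerPath.kContinuous_eval.comp (f := fun p : W × PowerPath W Z => (p.2, p.1))
    (Continuous.kContinuous (by fun_prop))⟩

theorem IsFamily.toPower_eval {φ₀ : X.State → Z.State} {φ : W → (X ⟶ Z)} (hφ : IsFamily φ₀ φ)
    (w : W) : hφ.toPower ≫ powerEval w = φ w :=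
  hom_ext (fun a => (congrFun (hφ.onState w) a).symm) fun _ => rfl

theorem power_hom_ext {f g : X ⟶ power W Z}
    (h : Hom.onState (Y := power W Z) f = Hom.onState (Y := power W Z) g)
    (h' : ∀ w : W, f ≫ powerEval w = g ≫ powerEval w) : f = g := by
  refine hom_ext (congrFun h) fun x => PowerPath.ext ?_ ?_ ?_
  · exact (Hom.src_onPath f x).trans ((congrFun h _).trans (Hom.src_onPath g x).symm)
  · exact (Hom.tgt_onPath f x).trans ((congrFun h _).trans (Hom.tgt_onPath g x).symm)
  · exact funext fun w => congrFun (congrArg Hom.onPath (h' w)) x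

/-- The transposes of a family with two parameters form a family. -/
theorem IsFamily.toPower_family {V : Type u} [TopologicalSpace V] {φ₀ : X.State → Z.State}
    {φ : V × W → (X ⟶ Z)} (hφ : IsFamily φ₀ φ) :
    IsFamily (Z := power W Z) φ₀ fun v : V =>
      (hφ.reparam (V := W) (c := fun w => (v, w))
        (Continuous.kContinuous (by fun_prop))).toPower where
  onState _ := rfl
  kContinuous := by
    intro K _ _ _ c hc
    refine PowerPath.continuous_mk ?_ ?_ ?_
    · exact @Continuous.comp _ _ _ _ ⊥ ⊥ _ φ₀ continuous_bot (X.continuous_src.comp hc.snd)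
    · exact @Continuous.comp _ _ _ _ ⊥ ⊥ _ φ₀ continuous_bot (X.continuous_tgt.comp hc.snd)
    · exact hφ.kContinuous.comp (f := fun p : K × W => (((c p.1).1, p.2), (c p.1).2))
        (Continuous.kContinuous (by fun_prop))

end Power

/-! ### Families on `W ⊠ X` and on pushouts -/

section Gluing

variable {V W : Type u} [TopologicalSpace V] [TopologicalSpace W] {A X Y Z : Flot.{u}}

/-- A family with parameters in `V × W` is a family with parameters in `V` of morphisms out
of `W ⊠ X`. -/
theorem IsFamily.exists_box {φ₀ : X.State → Z.State} {φ : V × W → (X ⟶ Z)}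
    (hφ : IsFamily φ₀ φ) : ∃ ψ : V → (box W X ⟶ Z), IsFamily (X := box W X) φ₀ ψ ∧
      ∀ v w, boxIn w X ≫ ψ v = φ (v, w) := by
  -- The parameter `v` is absorbed into the target: the family becomes one indexed by `W` with
  -- values in `power V Z`, hence a single morphism `W ⊠ X ⟶ power V Z`, which is then evaluated at
  -- `v`.
  have h := (hφ.reparam continuous_swap.kContinuous).toPower_family
  have h' := (isFamily_powerEval (W := V) (Z := Z)).constComp h.desc
  refine ⟨fun v => h.desc ≫ powerEval v, h', fun v w => ?_⟩
  rw [← Category.assoc, h.boxIn_desc, IsFamily.toPower_eval]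
  rfl

/-- Families on two flows that agree on a third one glue to a family on the pushout. -/
theorem IsFamily.exists_pushout {f : A ⟶ X} {g : A ⟶ Y} {φ₀ : X.State → Z.State}
    {ψ₀ : Y.State → Z.State} {φ : W → (X ⟶ Z)} {ψ : W → (Y ⟶ Z)} (hφ : IsFamily φ₀ φ)
    (hψ : IsFamily ψ₀ ψ) (h₀ : φ₀ ∘ Hom.onState f = ψ₀ ∘ Hom.onState g)
    (h : ∀ w, f ≫ φ w = g ≫ ψ w) : ∃ (χ₀ : (pushout f g).State → Z.State)
      (χ : W → (pushout f g ⟶ Z)), IsFamily χ₀ χ ∧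
      ∀ w, pushout.inl f g ≫ χ w = φ w ∧ pushout.inr f g ≫ χ w = ψ w := by
  -- The transposes are single morphisms into `power W Z`, so gluing them is the universal property
  -- of the pushout.
  have e : f ≫ hφ.toPower = g ≫ hψ.toPower := by
    refine power_hom_ext h₀ fun w => ?_
    rw [Category.assoc, Category.assoc, hφ.toPower_eval, hψ.toPower_eval, h]
  refine ⟨_, fun w => pushout.desc _ _ e ≫ powerEval w,
    isFamily_powerEval.constComp _, fun w => ⟨?_, ?_⟩⟩
  · rw [← Category.assoc, pushout.inl_desc, hφ.toPower_eval]
  · rw [← Category.assoc, pushout.inr_desc, hψ.toPower_eval]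

end Gluing

end Flot

/-! ### Homotopy extension with parameters -/

namespace Flot

section Extension

variable {A X Z : Flot.{u}} {i : A ⟶ X} {W : Type u} [TopologicalSpace W]

/-- The S-homotopy extension property with parameters. -/
theorem IsSCofibration.exists_family (hi : IsSCofibration i) {φ₀ : X.State → Z.State}
    {G : W → (X ⟶ Z)} (hG : IsFamily φ₀ G) {K : Interval.{u} × W → (A ⟶ Z)}
    (hK : IsFamily (φ₀ ∘ Hom.onState i) K) (h : ∀ w, K (ULift.up 0, w) = i ≫ G w) :
    ∃ Φ : Interval.{u} × W → (X ⟶ Z), IsFamily φ₀ Φ ∧ (∀ w, Φ (ULift.up 0, w) = G w) ∧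
      ∀ p, i ≫ Φ p = K p := by
  have hK' := hK.toPower_family
  obtain ⟨H, hH, hH₀⟩ := hi (power W Z) hG.toPower hK'.desc (by
    rw [hK'.boxIn_desc]
    refine power_hom_ext rfl fun w => ?_
    rw [IsFamily.toPower_eval, Category.assoc, hG.toPower_eval, h])
  have hs : Hom.onState (X := box Interval.{u} X) (Y := power W Z) H = φ₀ :=
    congrArg Hom.onState hH₀
  have hΦ : IsFamily (X := X) (Z := Z)
      (id ∘ (Hom.onState (X := box Interval.{u} X) (Y := power W Z) H ∘ id))
      fun p : Interval.{u} × W => (boxIn p.1 X ≫ H) ≫ powerEval p.2 :=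
    (((isFamily_boxIn (W := Interval.{u}) (X := X)).compConst H).reparam
      (c := fun p : Interval.{u} × W => p.1)
      (Continuous.kContinuous (by fun_prop))).comp
      ((isFamily_powerEval (W := W) (Z := Z)).reparam (c := fun p : Interval.{u} × W => p.2)
        (Continuous.kContinuous (by fun_prop)))
  rw [hs] at hΦ
  refine ⟨_, hΦ, fun w => ?_, fun p => ?_⟩
  · rw [hH₀, hG.toPower_eval]
  · rw [← Category.assoc, hH, hK'.boxIn_desc, IsFamily.toPower_eval]

/-- Families extend along `M ⊆ P` relative to an S-cofibration if `(P, M)` is a retract of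
`([0, 1] × P, {0} × P)`. -/
theorem IsSCofibration.exists_extension (hi : IsSCofibration i) {M : Set W}
    {σ : W → Interval.{u}} (hσ : Continuous σ) {r : Interval.{u} × W → W} (hr : Continuous r)
    (hr₀ : ∀ z, r (ULift.up 0, z) ∈ M) (hrσ : ∀ z, r (σ z, z) = z)
    (hσM : ∀ z ∈ M, σ z = ULift.up 0) {φ₀ : X.State → Z.State} {F : M → (X ⟶ Z)}
    (hF : IsFamily φ₀ F) {K : W → (A ⟶ Z)} (hK : IsFamily (φ₀ ∘ Hom.onState i) K)
    (h : ∀ z : M, K z = i ≫ F z) :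
    ∃ Φ : W → (X ⟶ Z), IsFamily φ₀ Φ ∧ (∀ z : M, Φ z = F z) ∧ ∀ z, i ≫ Φ z = K z := by
  -- The data are pulled back along `r`, whose time-zero part lands in `M`, and extended there.
  -- Restriction along the section `z ↦ (σ z, z)` of `r` returns to the original problem.
  obtain ⟨Φ, hΦ, hΦ₀, hΦK⟩ := hi.exists_family
    (hF.reparam (c := fun z => ⟨r (ULift.up 0, z), hr₀ z⟩)
      (Continuous.kContinuous (by fun_prop)))
    (hK.reparam hr.kContinuous) (fun z => h ⟨_, hr₀ z⟩)
  refine ⟨_, hΦ.reparam (c := fun z => (σ z, z)) (Continuous.kContinuous (by fun_prop)),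
    fun z => ?_, fun z => ?_⟩
  · simp only [hσM z z.2, hΦ₀]
    congr 1
    ext
    have := hrσ z
    rwa [hσM z z.2] at this
  · rw [hΦK, hrσ]

end Extension

end Flot

/-! ### The retraction attached to an NDR pair -/

namespace RepresentsNDR

variable {Y : Type u} [TopologicalSpace Y] {B : Set Y} {u : C(Y, unitInterval)}
  {h : C(unitInterval × Y, Y)}

theorem isClosed (H : RepresentsNDR B u h) : IsClosed B := by
  rw [H.zero_set]
  exact isClosed_singleton.preimage u.continuous

theorem mem_iff (H : RepresentsNDR B u h) {y : Y} : y ∈ B ↔ (u y : ℝ) = 0 := by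
  conv_lhs => rw [H.zero_set]
  exact ⟨fun h => congrArg Subtype.val h, fun h => Subtype.ext h⟩

/-- The deformation of an NDR pair may be reparametrised by a function that is discontinuous over
the subspace. -/
theorem continuous_reparam (H : RepresentsNDR B u h) {T : Type*} [TopologicalSpace T] {y : T → Y}
    (hy : Continuous y) {c : T → unitInterval} (hc : ∀ τ, y τ ∉ B → ContinuousAt c τ) :
    Continuous fun τ => h (c τ, y τ) := by
  refine continuous_iff_continuousAt.2 fun τ => ?_
  by_cases hτ : y τ ∈ B
  · rw [ContinuousAt, H.h_fix _ _ hτ]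
    intro N hN
    -- Tube lemma: `h` sends all of `[0, 1] × {y τ}` into `N`, hence also `[0, 1] × {y'}` for `y'`
    -- near `y τ`. The value of `c` does not matter.
    have := (isCompact_univ (X := unitInterval)).eventually_forall_of_forall_eventually
      (x₀ := y τ) (P := fun y s => h (s, y) ∈ N) fun s _ => by
        have hc : ContinuousAt (fun z : Y × unitInterval => h (z.2, z.1)) (y τ, s) := by fun_prop
        exact hc (by simpa only [H.h_fix s _ hτ] using hN)
    exact (hy.continuousAt.eventually this).mono fun τ' h' => h' _ (Set.mem_univ _)
  · exact h.continuous.continuousAt.comp ((hc τ hτ).prodMk hy.continuousAt)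

/-- `([0, 1] × Y, {0} × Y ∪ [0, 1] × B)` is a retract of `([0, 1]² × Y, {0} × [0, 1] × Y)`. -/
theorem exists_retract (H : RepresentsNDR B u h) :
    ∃ (σ : Flot.Interval.{u} × Y → Flot.Interval.{u})
      (r : Flot.Interval.{u} × (Flot.Interval.{u} × Y) → Flot.Interval.{u} × Y),
      Continuous σ ∧ Continuous r ∧
      (∀ z, r (ULift.up 0, z) ∈ {z | z.1 = ULift.up 0 ∨ z.2 ∈ B}) ∧
      (∀ z, r (σ z, z) = z) ∧
      ∀ z ∈ {z : Flot.Interval.{u} × Y | z.1 = ULift.up 0 ∨ z.2 ∈ B}, σ z = ULift.up 0 := by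
  -- At time `s` the point `(t, y)` goes to `(t - m, h (m / u y, y))`, with `m` the excess of `min t
  -- (u y)` over `s`. At `s = 0` there are two cases: if `t ≤ u y`, the first coordinate drops to
  -- `0`; otherwise `u y < t ≤ 1` and the full deformation takes `y` into `B`. At `s = σ (t, y) =
  -- min t (u y)` the excess vanishes and nothing moves.
  let m : Flot.Interval.{u} × (Flot.Interval.{u} × Y) → ℝ :=
    fun p => max (min (p.2.1.down : ℝ) (u p.2.2) - p.1.down) 0
  have hm : Continuous m := by fun_prop
  -- Over `B` the quotient is `0 / 0 = 0`, and `k` may be discontinuous there; `continuous_reparam`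
  -- is what makes this harmless.
  let k : Flot.Interval.{u} × (Flot.Interval.{u} × Y) → unitInterval :=
    fun p => Set.projIcc 0 1 zero_le_one (m p / u p.2.2)
  have hσ (z : Flot.Interval.{u} × Y) :
      m (ULift.up (min z.1.down (u z.2)), z) = 0 := by
    simp only [m]
    rcases le_total z.1.down (u z.2) with h' | h' <;> simp [h']
  refine ⟨fun z => ULift.up (min z.1.down (u z.2)),
    fun p => (ULift.up (Set.projIcc 0 1 zero_le_one (p.2.1.down - m p)), h (k p, p.2.2)),
    by fun_prop, ?_, ?_, ?_, ?_⟩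
  · refine Continuous.prodMk (continuous_uliftUp.comp (continuous_projIcc.comp (by fun_prop))) ?_
    refine H.continuous_reparam (by fun_prop) fun p hp => ?_
    have hp' : (u p.2.2 : ℝ) ≠ 0 := fun h' => hp (H.mem_iff.2 h')
    exact continuous_projIcc.continuousAt.comp
      (ContinuousAt.div hm.continuousAt (by fun_prop) hp')
  · rintro ⟨⟨t⟩, y⟩
    rcases le_or_gt t (u y) with ht | ht
    · left
      have : (t : ℝ) ≤ u y := ht
      simp [m, this, t.2.1]
    · right
      have ht' : (u y : ℝ) < t := ht
      have hm : m (ULift.up 0, (ULift.up t, y)) = u y := by simp [m, ht'.le, (u y).2.1]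
      by_cases hy : y ∈ B
      · simpa [H.h_fix _ _ hy] using hy
      · have hk : k (ULift.up 0, (ULift.up t, y)) = 1 := by
          simp only [k, hm]
          rw [div_self fun h' => hy (H.mem_iff.2 h')]
          exact Set.projIcc_right _
        simpa only [hk] using H.h_one y (lt_of_lt_of_le ht t.2.2)
  · rintro z
    simp only [k, hσ, zero_div, sub_zero, Set.projIcc_val]
    have : Set.projIcc (0 : ℝ) 1 zero_le_one 0 = 0 := Set.projIcc_left _
    rw [this, H.h_zero]
  · rintro ⟨⟨t⟩, y⟩ (h' | h')
    · obtain rfl : t = 0 := congrArg ULift.down h'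
      simp
    · have : u y = 0 := Subtype.ext (H.mem_iff.1 h')
      simp [this]

end RepresentsNDR

/-! ### The S-cofibration property of `(Y, B) ⊠ i` -/

namespace Flot

section PushoutBox

variable {Y : Type u} [TopologicalSpace Y] {B : Set Y} {A X Z : Flot.{u}} {i : A ⟶ X}

theorem boxIn_boxMap {U V : Type u} [TopologicalSpace U] [TopologicalSpace V] (c : C(U, V))
    (f : A ⟶ X) (y : U) : boxIn y A ≫ boxMap c f = f ≫ boxIn (c y) X :=
  hom_ext (fun _ => rfl) fun _ => rfl

variable (B i) in
/-- The domain of `pushoutBox B i`. -/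
noncomputable abbrev boxPushout : Flot.{u} :=
  pushout (boxMap (subspaceIncl B) (𝟙 A)) (boxMap (ContinuousMap.id B) i)

variable (B i) in
/-- The inclusion of `Y ⊠ A`. -/
noncomputable abbrev boxInl : box Y A ⟶ boxPushout B i := pushout.inl _ _

variable (B i) in
/-- The inclusion of `B ⊠ X`. -/
noncomputable abbrev boxInr : box B X ⟶ boxPushout B i := pushout.inr _ _

theorem boxInl_pushoutBox : boxInl B i ≫ pushoutBox B i = boxMap (ContinuousMap.id Y) i :=
  pushout.inl_desc _ _ _

theorem boxInr_pushoutBox : boxInr B i ≫ pushoutBox B i = boxMap (subspaceIncl B) (𝟙 X) :=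
  pushout.inr_desc _ _ _

theorem boxIn_boxInl (b : B) : boxIn b.1 A ≫ boxInl B i = i ≫ boxIn b X ≫ boxInr B i := by
  have h : boxIn b A ≫ boxMap (subspaceIncl B) (𝟙 A) ≫ boxInl B i =
      boxIn b A ≫ boxMap (ContinuousMap.id B) i ≫ boxInr B i :=
    congrArg (boxIn b A ≫ ·) pushout.condition
  rw [← Category.assoc, ← Category.assoc, boxIn_boxMap, boxIn_boxMap, Category.id_comp,
    Category.assoc] at h
  exact h

/-- Families over two pieces of `{0} × Y ∪ [0, 1] × B` glue. -/
theorem IsFamily.exists_glue (hB : IsClosed B) {φ₀ : X.State → Z.State} {G : Y → (X ⟶ Z)}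
    (hG : IsFamily φ₀ G) {N : Interval.{u} × B → (X ⟶ Z)} (hN : IsFamily φ₀ N)
    (h : ∀ b : B, N (ULift.up 0, b) = G b) :
    ∃ F : {z : Interval.{u} × Y | z.1 = ULift.up 0 ∨ z.2 ∈ B} → (X ⟶ Z), IsFamily φ₀ F ∧
      (∀ y, F ⟨(ULift.up 0, y), Or.inl rfl⟩ = G y) ∧
      ∀ t (b : B), F ⟨(t, b), Or.inr b.2⟩ = N (t, b) := by
  classical
  let F : {z : Interval.{u} × Y | z.1 = ULift.up 0 ∨ z.2 ∈ B} → (X ⟶ Z) :=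
    fun z => if hz : z.1.2 ∈ B then N (z.1.1, ⟨z.1.2, hz⟩) else G z.1.2
  have hF₀ : ∀ z, z.1.1 = ULift.up 0 → F z = G z.1.2 := by
    rintro ⟨⟨t, y⟩, hz⟩ rfl
    by_cases hy : y ∈ B
    · simpa only [F, dif_pos hy] using h ⟨y, hy⟩
    · simp only [F, dif_neg hy]
  have hFB : ∀ z (hz : z.1.2 ∈ B), F z = N (z.1.1, ⟨z.1.2, hz⟩) := fun z hz => dif_pos hz
  refine ⟨F, ⟨fun z => ?_, ?_⟩, fun y => hF₀ _ rfl, fun t b => hFB _ b.2⟩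
  · rcases z.2 with hz | hz
    · rw [hF₀ z hz, hG.onState]
    · rw [hFB z hz, hN.onState]
  · refine KContinuous.of_isClosed_union
      (s := {p | p.1.1.1 = ULift.up 0}) (t := {p | p.1.1.2 ∈ B}) ?_ ?_ (fun p => p.1.2) ?_ ?_
    · exact isClosed_eq (by fun_prop) (by fun_prop)
    · exact hB.preimage (by fun_prop)
    · have e := hG.kContinuous.comp (X := {p : {z : Interval.{u} × Y | z.1 = ULift.up 0 ∨ z.2 ∈ B} ×
        X.Path | p.1.1.1 = ULift.up 0}) (f := fun p => (p.1.1.1.2, p.1.2))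
        (Continuous.kContinuous (by fun_prop))
      convert e using 2 with p
      rw [hF₀ _ p.2]
    · have e := hN.kContinuous.comp (X := {p : {z : Interval.{u} × Y | z.1 = ULift.up 0 ∨ z.2 ∈ B} ×
        X.Path | p.1.1.2 ∈ B}) (f := fun p => ((p.1.1.1.1, ⟨p.1.1.1.2, p.2⟩), p.1.2))
        (Continuous.kContinuous (by fun_prop))
      convert e using 2 with p
      rw [hFB _ p.2]

/-- If `(Y, B)` is an NDR pair and `i` is an S-cofibration, then so is `(Y, B) ⊠ i`. -/
theorem pushoutBox_isSCofibration (hYB : IsNDRPair Y B) (hi : IsSCofibration i) :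
    IsSCofibration (pushoutBox B i) := by
  obtain ⟨v, h, hvh⟩ := hYB
  intro Z g H hH
  let Q : Flot.{u} := boxPushout B i
  let inl : box Y A ⟶ Q := boxInl B i
  let inr : box B X ⟶ Q := boxInr B i
  have hinl : inl ≫ pushoutBox B i = boxMap (ContinuousMap.id Y) i := boxInl_pushoutBox
  have hinr : inr ≫ pushoutBox B i = boxMap (subspaceIncl B) (𝟙 X) := boxInr_pushoutBox
  have hcond : ∀ b : B, boxIn b.1 A ≫ inl = i ≫ boxIn b X ≫ inr := boxIn_boxInl
  -- The morphisms `g` and `H` are unpacked into families: on `X` over `{0} × Y` (`hG`), on `A` over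
  -- `[0, 1] × Y` (`hK`), and on `X` over `[0, 1] × B` (`hN`). All have state maps induced by `g`.
  have hG : IsFamily (X := X) (Hom.onState (X := box Y X) g) fun y : Y => boxIn y X ≫ g :=
    isFamily_boxIn_comp g
  have hs : Hom.onState (X := box Interval.{u} Q) H = Hom.onState (pushoutBox B i ≫ g) :=
    congrArg Hom.onState hH
  have hK : IsFamily (Hom.onState (X := box Y X) g ∘ Hom.onState (Y := X) i)
      fun z : Interval.{u} × Y => (boxIn z.2 A ≫ inl) ≫ boxIn z.1 Q ≫ H := by
    have := ((isFamily_boxIn_comp inl).reparam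
      (c := fun z : Interval.{u} × Y => z.2) (Continuous.kContinuous (by fun_prop))).comp
        ((isFamily_boxIn_comp H).reparam (c := fun z => z.1) (Continuous.kContinuous (by fun_prop)))
    rw [hs] at this
    have e : Hom.onState (inl ≫ pushoutBox B i ≫ g) =
      Hom.onState (boxMap (ContinuousMap.id Y) i ≫ g) := by rw [← hinl, Category.assoc]
    exact this.congrState e
  have hN : IsFamily (X := X) (Hom.onState (X := box Y X) g)
      fun z : Interval.{u} × B => (boxIn z.2 X ≫ inr) ≫ boxIn z.1 Q ≫ H := by
    have := ((isFamily_boxIn_comp inr).reparam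
      (c := fun z : Interval.{u} × B => z.2) (Continuous.kContinuous (by fun_prop))).comp
        ((isFamily_boxIn_comp H).reparam (c := fun z => z.1) (Continuous.kContinuous (by fun_prop)))
    rw [hs] at this
    have e : Hom.onState (inr ≫ pushoutBox B i ≫ g) =
      Hom.onState (boxMap (subspaceIncl B) (𝟙 X) ≫ g) := by rw [← hinr, Category.assoc]
    exact this.congrState e
  -- On the overlap `{0} × B` both families are given by `g`, by the initial condition on `H`.
  obtain ⟨F, hF, hF₀, hFB⟩ := IsFamily.exists_glue hvh.isClosed hG hN fun b => by
    rw [hH, Category.assoc, ← Category.assoc inr, hinr, ← Category.assoc, boxIn_boxMap,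
      Category.id_comp]
    rfl
  obtain ⟨σ, r, hσ, hr, hr₀, hrσ, hσM⟩ := hvh.exists_retract
  obtain ⟨Φ, hΦ, hΦF, hΦK⟩ := hi.exists_extension hσ hr hr₀ hrσ hσM hF hK (by
    rintro ⟨⟨t, y⟩, (h' | h')⟩
    · obtain rfl : t = ULift.up 0 := h'
      rw [hF₀, hH]
      simp only [Category.assoc]
      rw [← Category.assoc inl, hinl, ← Category.assoc, boxIn_boxMap, Category.assoc]
      rfl
    · rw [hFB t ⟨y, h'⟩]
      simp only [← Category.assoc]
      rw [Category.assoc i, ← hcond ⟨y, h'⟩])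
  obtain ⟨Ψ, hΨ, hΨΦ⟩ := hΦ.exists_box
  refine ⟨hΨ.desc, fun t => ?_, ?_⟩
  · rw [hΨ.boxIn_desc]
    -- States are compared separately, since `Y` or `B` may be empty.
    have hst : Hom.onState (pushoutBox B i ≫ Ψ t) = Hom.onState (boxIn t Q ≫ H) := by
      rw [comp_onState, hΨ.onState]
      exact hs.symm
    refine pushout.hom_ext ?_ ?_
    · refine box_hom_ext_boxIn ?_ fun y => ?_
      · exact congrArg (· ∘ Hom.onState inl) hst
      · change boxIn y A ≫ inl ≫ _ = boxIn y A ≫ inl ≫ _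
        rw [← Category.assoc inl, hinl, ← Category.assoc, boxIn_boxMap, Category.assoc]
        exact (congrArg (i ≫ ·) (hΨΦ t y)).trans ((hΦK (t, y)).trans (Category.assoc _ _ _))
    · refine box_hom_ext_boxIn ?_ fun b => ?_
      · exact congrArg (· ∘ Hom.onState inr) hst
      · change boxIn b X ≫ inr ≫ _ = boxIn b X ≫ inr ≫ _
        rw [← Category.assoc inr, hinr, ← Category.assoc, boxIn_boxMap, Category.id_comp]
        refine (hΨΦ t b).trans ((hΦF ⟨(t, b), Or.inr b.2⟩).trans ?_)
        rw [hFB, Category.assoc]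
  · rw [hΨ.boxIn_desc]
    refine box_hom_ext_boxIn (hΨ.onState _) fun y => ?_
    rw [hΨΦ, hΦF ⟨(ULift.up 0, y), Or.inl rfl⟩, hF₀]

end PushoutBox

end Flot

namespace Flot

section SHomotopy

variable {A X Y Z : Flot.{u}}

/-! ### S-homotopies as families -/

/-- An S-homotopy asks for continuity on the ordinary product with `[0, 1]`. This agrees with
k-continuity because the path space is compactly generated and `[0, 1]` is compact Hausdorff. -/
theorem IsFamily.sHomotopic {φ₀ : X.State → Z.State} {φ : Interval.{u} → (X ⟶ Z)}
    (hφ : IsFamily φ₀ φ) : SHomotopic (φ (ULift.up 0)) (φ (ULift.up 1)) := by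
  refine ⟨fun t => φ (ULift.up t), ?_, ?_, rfl, rfl⟩
  · simp only [hφ.onState]
    exact (continuous_of_discreteTopology (f := φ₀)).comp continuous_fst
  · have h : Continuous fun p : X.Path × Interval.{u} => Hom.onPath (φ p.2) p.1 :=
      (hφ.kContinuous.comp (f := fun p : X.Path × Interval.{u} => (p.2, p.1))
        (Continuous.kContinuous (by fun_prop))).continuous_prod
    exact h.comp (f := fun p : X.Path × unitInterval => (p.1, ULift.up p.2)) (by fun_prop)

/-- The states are discrete and `[0, 1]` is connected, so the map on states cannot vary along an
S-homotopy. -/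
theorem SHomotopic.exists_family {f g : X ⟶ Z} (h : SHomotopic f g) :
    Hom.onState f = Hom.onState g ∧ ∃ φ : Interval.{u} → (X ⟶ Z),
      IsFamily (Hom.onState f) φ ∧ φ (ULift.up 0) = f ∧ φ (ULift.up 1) = g := by
  obtain ⟨H, h₁, h₂, h₃, h₄⟩ := h
  have hs (t : unitInterval) : Hom.onState (H t) = Hom.onState f := by
    ext a
    have hc : Continuous fun t : unitInterval => Hom.onState (H t) a :=
      h₁.comp (f := fun t => (a, t)) (by fun_prop)
    rw [← h₃]
    exact PreconnectedSpace.constant inferInstance hc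
  refine ⟨by rw [← h₄, hs], fun t => H t.down, ⟨fun t => hs _, ?_⟩, h₃, h₄⟩
  exact (h₂.comp (f := fun p : Interval.{u} × X.Path => (p.2, p.1.down))
    (by fun_prop)).kContinuous

theorem IsFamily.symm {φ₀ : X.State → Z.State} {φ : Interval.{u} → (X ⟶ Z)}
    (hφ : IsFamily φ₀ φ) :
    IsFamily φ₀ fun t : Interval.{u} => φ (ULift.up (unitInterval.symm t.down)) :=
  hφ.reparam (c := fun t : Interval.{u} => ULift.up (unitInterval.symm t.down))
    (Continuous.kContinuous (by fun_prop))

/-- Concatenation of homotopies. -/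
theorem IsFamily.concat {φ₀ : X.State → Z.State} {φ ψ : Interval.{u} → (X ⟶ Z)}
    (hφ : IsFamily φ₀ φ) (hψ : IsFamily φ₀ ψ) (h : φ (ULift.up 1) = ψ (ULift.up 0)) :
    ∃ χ : Interval.{u} → (X ⟶ Z), IsFamily φ₀ χ ∧
      (∀ t, (t.down : ℝ) ≤ 1 / 2 →
        χ t = φ (ULift.up (Set.projIcc 0 1 zero_le_one (2 * t.down)))) ∧
      ∀ t, 1 / 2 ≤ (t.down : ℝ) →
        χ t = ψ (ULift.up (Set.projIcc 0 1 zero_le_one (2 * t.down - 1))) := by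
  classical
  let χ : Interval.{u} → (X ⟶ Z) := fun t => if (t.down : ℝ) ≤ 1 / 2 then
    φ (ULift.up (Set.projIcc 0 1 zero_le_one (2 * t.down))) else
    ψ (ULift.up (Set.projIcc 0 1 zero_le_one (2 * t.down - 1)))
  have h₁ : ∀ t, (t.down : ℝ) ≤ 1 / 2 →
      χ t = φ (ULift.up (Set.projIcc 0 1 zero_le_one (2 * t.down))) := fun t ht => if_pos ht
  have h₂ : ∀ t, 1 / 2 ≤ (t.down : ℝ) →
      χ t = ψ (ULift.up (Set.projIcc 0 1 zero_le_one (2 * t.down - 1))) := by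
    intro t ht
    rcases ht.eq_or_lt with ht | ht
    · rw [h₁ t ht.ge, ← ht, Set.projIcc_of_right_le _ (by norm_num),
        Set.projIcc_of_le_left _ (by norm_num)]
      exact h
    · exact if_neg ht.not_ge
  have c₁ : Continuous fun t : Interval.{u} => (ULift.up (Set.projIcc (0 : ℝ) 1 zero_le_one
      (2 * t.down)) : Interval.{u}) :=
    continuous_uliftUp.comp (continuous_projIcc.comp (by fun_prop))
  have c₂ : Continuous fun t : Interval.{u} => (ULift.up (Set.projIcc (0 : ℝ) 1 zero_le_one
      (2 * t.down - 1)) : Interval.{u}) :=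
    continuous_uliftUp.comp (continuous_projIcc.comp (by fun_prop))
  refine ⟨χ, ⟨fun t => ?_, ?_⟩, h₁, h₂⟩
  · rcases le_total (t.down : ℝ) (1 / 2) with ht | ht
    · rw [h₁ t ht, hφ.onState]
    · rw [h₂ t ht, hψ.onState]
  · refine KContinuous.of_isClosed_union
      (s := {p : Interval.{u} × X.Path | (p.1.down : ℝ) ≤ 1 / 2})
      (t := {p : Interval.{u} × X.Path | 1 / 2 ≤ (p.1.down : ℝ)}) ?_ ?_
      (fun p => le_total (p.1.down : ℝ) (1 / 2)) ?_ ?_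
    · exact isClosed_le (by fun_prop) (by fun_prop)
    · exact isClosed_le (by fun_prop) (by fun_prop)
    · have e := (hφ.reparam c₁.kContinuous).kContinuous.comp
        (X := {p : Interval.{u} × X.Path | (p.1.down : ℝ) ≤ 1 / 2}) (f := fun p => p.1)
        (Continuous.kContinuous (by fun_prop))
      convert e using 2 with p
      rw [h₁ _ p.2]
    · have e := (hψ.reparam c₂.kContinuous).kContinuous.comp
        (X := {p : Interval.{u} × X.Path | 1 / 2 ≤ (p.1.down : ℝ)}) (f := fun p => p.1)
        (Continuous.kContinuous (by fun_prop))
      convert e using 2 with p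
      rw [h₂ _ p.2]

theorem SHomotopic.trans {f g k : X ⟶ Z} (h : SHomotopic f g) (h' : SHomotopic g k) :
    SHomotopic f k := by
  obtain ⟨hs, φ, hφ, rfl, rfl⟩ := h.exists_family
  obtain ⟨-, ψ, hψ, h₀, rfl⟩ := h'.exists_family
  obtain ⟨χ, hχ, hχ₁, hχ₂⟩ := hφ.concat (hψ.congrState hs.symm) h₀.symm
  have e₀ : χ (ULift.up 0) = φ (ULift.up 0) := by
    rw [hχ₁ _ (by norm_num), Set.projIcc_of_le_left _ (by norm_num)]
    rfl
  have e₁ : χ (ULift.up 1) = ψ (ULift.up 1) := by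
    rw [hχ₂ _ (by norm_num), Set.projIcc_of_right_le _ (by norm_num)]
    rfl
  exact e₀ ▸ e₁ ▸ hχ.sHomotopic

theorem IsFamily.sHomotopic_box {W : Type u} [TopologicalSpace W] {φ₀ : X.State → Z.State}
    {φ : Interval.{u} × W → (X ⟶ Z)} (hφ : IsFamily φ₀ φ) {f g : box W X ⟶ Z}
    (hf : Hom.onState (X := box W X) f = φ₀) (hg : Hom.onState (X := box W X) g = φ₀)
    (hf' : ∀ w, boxIn w X ≫ f = φ (ULift.up 0, w))
    (hg' : ∀ w, boxIn w X ≫ g = φ (ULift.up 1, w)) : SHomotopic f g := by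
  obtain ⟨ψ, hψ, hψφ⟩ := hφ.exists_box
  have e₀ : ψ (ULift.up 0) = f :=
    box_hom_ext_boxIn ((hψ.onState _).trans hf.symm) fun w => by rw [hψφ, hf']
  have e₁ : ψ (ULift.up 1) = g :=
    box_hom_ext_boxIn ((hψ.onState _).trans hg.symm) fun w => by rw [hψφ, hg']
  exact e₀ ▸ e₁ ▸ hψ.sHomotopic

theorem IsFamily.sHomotopic_pushout {f : A ⟶ X} {g : A ⟶ Y} {φ₀ : X.State → Z.State}
    {ψ₀ : Y.State → Z.State} {φ : Interval.{u} → (X ⟶ Z)} {ψ : Interval.{u} → (Y ⟶ Z)}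
    (hφ : IsFamily φ₀ φ) (hψ : IsFamily ψ₀ ψ) (h : ∀ t, f ≫ φ t = g ≫ ψ t)
    {p q : pushout f g ⟶ Z} (hp : pushout.inl f g ≫ p = φ (ULift.up 0))
    (hp' : pushout.inr f g ≫ p = ψ (ULift.up 0)) (hq : pushout.inl f g ≫ q = φ (ULift.up 1))
    (hq' : pushout.inr f g ≫ q = ψ (ULift.up 1)) : SHomotopic p q := by
  have h₀ : φ₀ ∘ Hom.onState f = ψ₀ ∘ Hom.onState g := by
    rw [← hφ.onState (ULift.up 0), ← hψ.onState (ULift.up 0)]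
    exact congrArg Hom.onState (h (ULift.up 0))
  obtain ⟨χ₀, χ, hχ, hχ'⟩ := hφ.exists_pushout hψ h₀ h
  have e₀ : χ (ULift.up 0) = p :=
    pushout.hom_ext ((hχ' _).1.trans hp.symm) ((hχ' _).2.trans hp'.symm)
  have e₁ : χ (ULift.up 1) = q :=
    pushout.hom_ext ((hχ' _).1.trans hq.symm) ((hχ' _).2.trans hq'.symm)
  exact e₀ ▸ e₁ ▸ hχ.sHomotopic

/-! ### Acyclic S-cofibrations are strong deformation retracts -/

/-- A homotopy equivalence with the S-homotopy extension property has a strict left inverse. -/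
theorem IsAcyclicSCofibration.exists_retraction {i : A ⟶ X} (hi : IsAcyclicSCofibration i) :
    ∃ ρ : X ⟶ A, i ≫ ρ = 𝟙 A ∧ SHomotopic (ρ ≫ i) (𝟙 X) := by
  obtain ⟨hi, g, hg, hg'⟩ := hi
  obtain ⟨-, φ, hφ, hφ₀, hφ₁⟩ := hg'.exists_family
  -- The homotopy from `i ≫ g` to the identity extends to one starting at `g`. Its end is a strict
  -- retraction `ρ`, and the reversed extension gives `ρ ≫ i ≃ g ≫ i ≃ 𝟙 X`.
  obtain ⟨H, hH, hH₀⟩ := hi A g hφ.desc (by rw [hφ.boxIn_desc, hφ₀])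
  refine ⟨boxIn (ULift.up 1) X ≫ H, by rw [hH, hφ.boxIn_desc, hφ₁], SHomotopic.trans ?_ hg⟩
  have h := ((isFamily_boxIn_comp H).compConst i).symm.sHomotopic
  simp only [unitInterval.symm_zero, unitInterval.symm_one] at h
  rwa [hH₀] at h

/-- A homotopy `D` from `ρ ≫ i` to the identity may move `A`. Preceding it by the reverse of `(ρ ≫
i) ≫ D` gives a homotopy `E` with the same ends, whose restriction to `A` runs backwards and then
forwards along `i ≫ D`. Such a path contracts relative to its ends. Extending the contraction over
`X` gives a square of morphisms, and the three sides of it other than `E` form a homotopy that fixes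
`A`. -/
theorem IsAcyclicSCofibration.exists_deformation {i : A ⟶ X} (hi : IsAcyclicSCofibration i) :
    ∃ (ρ : X ⟶ A) (D : Interval.{u} → (X ⟶ X)), i ≫ ρ = 𝟙 A ∧ IsFamily id D ∧
      D (ULift.up 0) = ρ ≫ i ∧ D (ULift.up 1) = 𝟙 X ∧ ∀ t, i ≫ D t = i := by
  obtain ⟨ρ, hρ, h⟩ := hi.exists_retraction
  obtain ⟨hs, D, hD, hD₀, hD₁⟩ := h.exists_family
  replace hD : IsFamily id D := hD.congrState hs
  have hρρ : (ρ ≫ i) ≫ ρ ≫ i = ρ ≫ i := by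
    rw [Category.assoc, ← Category.assoc i, hρ, Category.id_comp]
  have hiρ (f : X ⟶ X) : i ≫ (ρ ≫ i) ≫ f = i ≫ f := by
    rw [← Category.assoc, ← Category.assoc i, hρ, Category.id_comp]
  obtain ⟨E, hE, hE₁, hE₂⟩ :=
    ((hD.symm.constComp (ρ ≫ i)).congrState hs).concat hD
      (by simp only [unitInterval.symm_one, hD₀, hρρ])
  -- The restriction of `E` to `A` is `i ≫ D |2t - 1|`. Replacing `|2t - 1|` by its maximum with `s`
  -- contracts it to the constant `i ≫ D 1 = i`, keeping the ends fixed.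
  let c : Interval.{u} × Interval.{u} → Interval.{u} := fun p =>
    ULift.up (Set.projIcc 0 1 zero_le_one (max p.1.down |2 * p.2.down - 1|))
  have hc : Continuous c := continuous_uliftUp.comp (continuous_projIcc.comp (by fun_prop))
  have hc₁ (p) (hp : 1 ≤ max (p.1.down : ℝ) |2 * p.2.down - 1|) : i ≫ D (c p) = i := by
    simp only [c, Set.projIcc_of_right_le _ hp]
    exact (congrArg (i ≫ ·) hD₁).trans (Category.comp_id i)
  obtain ⟨Φ, hΦ, hΦ₀, hΦc⟩ := hi.1.exists_family hE
    ((hD.reparam hc.kContinuous).constComp i) fun t => by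
      rcases le_total (t.down : ℝ) (1 / 2) with ht | ht
      · rw [hE₁ t ht, hiρ]
        congr 2
        ext
        simp only [c, unitInterval.coe_symm_eq, Set.coe_projIcc]
        rw [abs_of_nonpos (by linarith)]
        have := t.down.2.1
        rw [Set.Icc.coe_zero, max_eq_right (show (0 : ℝ) ≤ -(2 * t.down - 1) by linarith),
          min_eq_right, max_eq_right, min_eq_right, max_eq_right] <;> linarith
      · rw [hE₂ t ht]
        congr 2
        simp only [c]
        rw [abs_of_nonneg (by linarith), Set.Icc.coe_zero, max_eq_right (by linarith)]
  -- The path runs through `(0, 0)`, `(1, 0)`, `(1, 1)`, `(0, 1)`, spending a third of the time on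
  -- each side. On all three sides `max s |2t - 1| = 1`.
  let γ : Interval.{u} → Interval.{u} × Interval.{u} := fun θ =>
    (ULift.up (Set.projIcc 0 1 zero_le_one (min (3 * θ.down) (3 - 3 * θ.down))),
      ULift.up (Set.projIcc 0 1 zero_le_one (3 * θ.down - 1)))
  have hγ : Continuous γ :=
    (continuous_uliftUp.comp (continuous_projIcc.comp (by fun_prop))).prodMk
      (continuous_uliftUp.comp (continuous_projIcc.comp (by fun_prop)))
  refine ⟨ρ, fun θ => Φ (γ θ), hρ, hΦ.reparam hγ.kContinuous, ?_, ?_, fun θ => ?_⟩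
  · have : γ (ULift.up 0) = (ULift.up 0, ULift.up 0) := by
      simp only [γ]
      rw [Set.projIcc_of_le_left _ (by norm_num), Set.projIcc_of_le_left _ (by norm_num)]
      rfl
    simp only [this, hΦ₀]
    rw [hE₁ _ (by norm_num), Set.projIcc_of_le_left _ (by norm_num)]
    change (ρ ≫ i) ≫ D (ULift.up (unitInterval.symm 0)) = _
    rw [unitInterval.symm_zero, hD₁, Category.comp_id]
  · have : γ (ULift.up 1) = (ULift.up 0, ULift.up 1) := by
      simp only [γ]
      rw [Set.projIcc_of_le_left _ (by norm_num), Set.projIcc_of_right_le _ (by norm_num)]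
      rfl
    simp only [this, hΦ₀]
    rw [hE₂ _ (by norm_num), Set.projIcc_of_right_le _ (by norm_num)]
    exact hD₁
  · rw [hΦc]
    refine hc₁ _ ?_
    rcases le_total (3 * (θ.down : ℝ) - 1) 0 with h₁ | h₁
    · refine le_max_of_le_right ?_
      simp only [γ, Set.projIcc_of_le_left _ h₁]
      norm_num
    · rcases le_total 1 (3 * (θ.down : ℝ) - 1) with h₂ | h₂
      · refine le_max_of_le_right ?_
        simp only [γ, Set.projIcc_of_right_le _ h₂]
        norm_num
      · refine le_max_of_le_left ?_
        have : 1 ≤ min (3 * (θ.down : ℝ)) (3 - 3 * θ.down) :=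
          le_min (by linarith) (by linarith)
        simp only [γ, Set.projIcc_of_right_le _ this]
        norm_num

end SHomotopy

/-! ### Acyclicity of `(Y, B) ⊠ i` -/

section PushoutBox

variable {Y : Type u} [TopologicalSpace Y] {B : Set Y} {A X : Flot.{u}} {i : A ⟶ X}

/-- The gluing condition on states, in a form that needs no point of `B`. -/
theorem boxInl_onState : Hom.onState (X := box Y A) (boxInl B i) =
    Hom.onState (X := box B X) (boxInr B i) ∘ Hom.onState (Y := X) i :=
  congrArg Hom.onState (pushout.condition (f := boxMap (subspaceIncl B) (𝟙 A))
    (g := boxMap (ContinuousMap.id B) i))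

/-- If `(Y, B)` is a DR pair, then `(Y, B) ⊠ i` is an S-homotopy equivalence. -/
theorem pushoutBox_isSHomotopyEquiv_of_isDRPair (hYB : IsDRPair Y B) :
    IsSHomotopyEquiv (pushoutBox B i) := by
  obtain ⟨v, h, hvh, h₁⟩ := hYB
  let c : C(Y, B) := ⟨fun y => ⟨h (1, y), h₁ y⟩, by fun_prop⟩
  have hr : Continuous fun p : Interval.{u} × Y => h (unitInterval.symm p.1.down, p.2) := by
    fun_prop
  -- The inverse retracts `Y ⊠ X` to `B ⊠ X` by `h (1, -)`. Both homotopies run `h` backwards in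
  -- time, so as to end at the identity.
  refine ⟨boxMap c (𝟙 X) ≫ boxInr B i, ?_, ?_⟩
  · rw [Category.assoc, boxInr_pushoutBox]
    refine (isFamily_boxIn.reparam hr.kContinuous).sHomotopic_box rfl rfl (fun y => ?_)
      fun y => ?_
    · rw [← Category.assoc, boxIn_boxMap, Category.assoc, boxIn_boxMap, unitInterval.symm_zero]
      rfl
    · rw [unitInterval.symm_one, hvh.h_zero, Category.comp_id]
  · obtain ⟨Ψ, hΨ, hΨ'⟩ :=
      ((isFamily_boxIn_comp (boxInl B i)).reparam hr.kContinuous).exists_box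
    -- The deformation acts on `Y ⊠ A` and is constant on `B ⊠ X`. The two agree on `B ⊠ A` because
    -- `h` fixes `B`.
    refine hΨ.sHomotopic_pushout (isFamily_const (boxInr B i)) (fun t => ?_) ?_ ?_ ?_ ?_
    · refine box_hom_ext_boxIn ?_ fun b => ?_
      · exact (hΨ.onState t).trans boxInl_onState
      · rw [← Category.assoc, boxIn_boxMap, Category.id_comp, ← Category.assoc, boxIn_boxMap,
          Category.assoc]
        refine (hΨ' t b).trans ?_
        rw [hvh.h_fix _ _ b.2]
        exact boxIn_boxInl b
    · refine box_hom_ext_boxIn ?_ fun y => ?_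
      · rw [hΨ.onState, boxInl_onState, ← Category.assoc, boxInl_pushoutBox]
        rfl
      · rw [hΨ', ← Category.assoc (boxInl B i), boxInl_pushoutBox, ← Category.assoc, boxIn_boxMap,
          Category.assoc, ← Category.assoc (boxIn _ _), boxIn_boxMap, Category.id_comp,
          unitInterval.symm_zero]
        exact (boxIn_boxInl (c y)).symm
    · rw [← Category.assoc, boxInr_pushoutBox]
      refine box_hom_ext_boxIn rfl fun b => ?_
      rw [← Category.assoc, boxIn_boxMap, Category.id_comp, ← Category.assoc, boxIn_boxMap,
        Category.id_comp]
      congr 2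
      exact Subtype.ext (hvh.h_fix 1 b b.2)
    · rw [Category.comp_id]
      refine box_hom_ext_boxIn (hΨ.onState _).symm fun y => ?_
      rw [hΨ', unitInterval.symm_one, hvh.h_zero]
    · rw [Category.comp_id]

/-- If `i` is an acyclic S-cofibration, then `(Y, B) ⊠ i` is an S-homotopy equivalence. -/
theorem pushoutBox_isSHomotopyEquiv_of_isAcyclicSCofibration (hi : IsAcyclicSCofibration i) :
    IsSHomotopyEquiv (pushoutBox B i) := by
  obtain ⟨ρ, D, hρ, hD, hD₀, hD₁, hDi⟩ := hi.exists_deformation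
  have hs : Hom.onState (ρ ≫ i) = id := by rw [← hD₀, hD.onState]
  -- The inverse retracts `Y ⊠ X` to `Y ⊠ A`; on `Y ⊠ X` the homotopy to the identity is `D`,
  -- applied at each point of `Y`.
  refine ⟨boxMap (ContinuousMap.id Y) ρ ≫ boxInl B i, ?_, ?_⟩
  · have hΦ := (hD.reparam (c := fun p : Interval.{u} × Y => p.1)
      (Continuous.kContinuous (by fun_prop))).comp ((isFamily_boxIn (W := Y)).reparam
        (c := fun p : Interval.{u} × Y => p.2) (Continuous.kContinuous (by fun_prop)))
    rw [Category.assoc, boxInl_pushoutBox]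
    refine hΦ.sHomotopic_box hs rfl (fun y => ?_) fun y => ?_
    · rw [← Category.assoc, boxIn_boxMap, Category.assoc, boxIn_boxMap, hD₀, Category.assoc]
      rfl
    · rw [hD₁, Category.comp_id, Category.id_comp]
  · obtain ⟨Ψ, hΨ, hΨ'⟩ := ((hD.reparam (c := fun p : Interval.{u} × B => p.1)
      (Continuous.kContinuous (by fun_prop))).comp ((isFamily_boxIn_comp (boxInr B i)).reparam
        (c := fun p : Interval.{u} × B => p.2) (Continuous.kContinuous (by fun_prop)))).exists_box
    -- Here the homotopy is constant on `Y ⊠ A` and is `D` on `B ⊠ X`. Agreement on `B ⊠ A` is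
    -- exactly `i ≫ D t = i`, so a deformation that moves `A` would not suffice.
    refine (isFamily_const (boxInl B i)).sHomotopic_pushout hΨ (fun t => ?_) ?_ ?_ ?_ ?_
    · rw [pushout.condition]
      refine box_hom_ext_boxIn ?_ fun b => ?_
      · exact (congrArg (· ∘ Hom.onState i) (hΨ.onState t)).symm
      · rw [← Category.assoc, boxIn_boxMap, ← Category.assoc, boxIn_boxMap, Category.assoc,
          Category.assoc]
        refine Eq.trans ?_ (congrArg (i ≫ ·) (hΨ' t b)).symm
        simp only [← Category.assoc, hDi]
        rfl
    · rw [← Category.assoc, boxInl_pushoutBox]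
      refine box_hom_ext_boxIn ?_ fun y => ?_
      · exact congrArg (Hom.onState (X := box Y A) (boxInl B i) ∘ ·) (congrArg Hom.onState hρ)
      · rw [← Category.assoc, boxIn_boxMap, Category.assoc, ← Category.assoc (boxIn _ _),
          boxIn_boxMap, ← Category.assoc, ← Category.assoc, hρ, Category.id_comp]
        rfl
    · rw [← Category.assoc, boxInr_pushoutBox]
      refine box_hom_ext_boxIn ?_ fun b => ?_
      · rw [hΨ.onState]
        exact (congrArg (· ∘ Hom.onState ρ) (boxInl_onState (B := B) (i := i))).trans
          (congrArg (Hom.onState (X := box B X) (boxInr B i) ∘ ·) hs)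
      · rw [hΨ', hD₀, ← Category.assoc, boxIn_boxMap, Category.id_comp, ← Category.assoc,
          boxIn_boxMap, Category.assoc, Category.assoc]
        exact congrArg (ρ ≫ ·) (boxIn_boxInl b)
    · rw [Category.comp_id]
    · rw [Category.comp_id]
      refine box_hom_ext_boxIn (hΨ.onState _).symm fun b => ?_
      rw [hΨ', hD₁, Category.id_comp]

end PushoutBox

end Flot

theorem mainTheorem5 (Y : Type u) [TopologicalSpace Y] [CompactlyGeneratedSpace Y]
    [WeaklyHausdorffSpace Y] (B : Set Y) (hYB : IsNDRPair Y B) {A X : Flot.{u}} (i : A ⟶ X)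
    (hi : Flot.IsSCofibration i) :
    Flot.IsSCofibration (Flot.pushoutBox B i) ∧
      (IsDRPair Y B ∨ Flot.IsAcyclicSCofibration i →
        Flot.IsAcyclicSCofibration (Flot.pushoutBox B i)) := by
  have h := Flot.pushoutBox_isSCofibration hYB hi
  refine ⟨h, fun h' => ⟨h, ?_⟩⟩
  rcases h' with h' | h'
  · exact Flot.pushoutBox_isSHomotopyEquiv_of_isDRPair h'
  · exact Flot.pushoutBox_isSHomotopyEquiv_of_isAcyclicSCofibration h'
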